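/- **Theorem 5.2.** Let $L=(L,\otimes,\to,0,1)$ be a BL-algebra, that is, a commutative monoid $(L,\otimes,1)$ with a binary operation $\to$ and an element $0$ such that for all $x,y,z\in L$ $$x\to x=1,\qquad x\otimes(x\to y)=y\otimes(y\to x),\qquad x\to(y\to z)=(x\otimes y)\to z,$$ $$0\to x=1,\qquad (x\to y)\to z\;\le\;((y\to x)\to z)\to z,$$ where $x\le y$ means $x\to y=1$; this is a lattice order. Put $\bar x=x\to 0$ and $x+y=(\bar x\to y)\wedge(\bar y\to x)$. A *good sequence* is a sequence $\mathbf a=(a_1,a_2,\dots)$ in $L$ with $a_i+a_{i+1}=a_i$ for all $i$ and $a_r=0$ for all large $r$; $M_L$ is the set of good sequences, $(0)$ is the zero sequence, and $\mathbf a\le\mathbf b$ means $a_i\le b_i$ for all $i$. For sequences, $\mathbf a+\mathbf b=(c_1,c_2,\dots)$ with $c_i=a_i+(a_{i-1}\otimes b_1)+\cdots+(a_1\otimes b_{i-1})+b_i$. Iterated sums without parentheses, both in $L$ and of sequences, are evaluated from left to right. Then sums $\mathbf a+\mathbf b$ and coordinatewise joins $\mathbf a\vee\mathbf b$ and meets $\mathbf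 a\wedge\mathbf b$ of good sequences are good sequences, and the relation on $M_L\times M_L$ $$(\mathbf a,\mathbf b)\sim(\mathbf c,\mathbf d)\iff \mathbf a+\mathbf d+\mathbf k=\mathbf b+\mathbf c+\mathbf k\ \text{ for some }\mathbf k\in M_L$$ is an equivalence relation. Let $G_L=(M_L\times M_L)/{\sim}$ and let $[\mathbf a,\mathbf b]$ be the class of $(\mathbf a,\mathbf b)$. The formulas $$[\mathbf a,\mathbf b]+[\mathbf c,\mathbf d]=[\mathbf a+\mathbf c,\mathbf b+\mathbf d],\qquad -[\mathbf a,\mathbf b]=[\mathbf b,\mathbf a],\qquad 0=[(0),(0)]$$ make $G_L$ an abelian group, and $$[\mathbf a,\mathbf b]\preceq[\mathbf c,\mathbf d]\iff \mathbf a+\mathbf d+\mathbf k\le\mathbf b+\mathbf c+\mathbf k\ \text{ for some }\mathbf k\in M_L$$ is a well-defined translation-invariant partial order on $G_L$ that makes it a lattice-ordered abelian group, with $$[\mathbf a,\mathbf b]\vee[\mathbf c,\mathbf d]=[(\mathbf a+\mathbf d)\vee(\mathbf b+\mathbf c),\ \mathbf b+\mathbf d],\qquad [\mathbf a,\mathbf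 b]\wedge[\mathbf c,\mathbf d]=[(\mathbf a+\mathbf d)\wedge(\mathbf b+\mathbf c),\ \mathbf b+\mathbf d].$$ -/

import Mathlib

/-- A BL-algebra: a bounded hoop `(L, *, ⇨, 0, 1)` with
`(x ⇨ y) ⇨ z ≤ ((y ⇨ x) ⇨ z) ⇨ z`, where `x ≤ y` means `x ⇨ y = 1`. -/
class BLAlgebra (L : Type*) extends CommMonoid L, Zero L, HImp L where
  imp_self : ∀ x : L, x ⇨ x = 1
  mul_imp_comm : ∀ x y : L, x * (x ⇨ y) = y * (y ⇨ x)
  imp_imp : ∀ x y z : L, x ⇨ (y ⇨ z) = (x * y) ⇨ z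
  zero_imp : ∀ x : L, (0 : L) ⇨ x = 1
  prelinear : ∀ x y z : L, ((x ⇨ y) ⇨ z) ⇨ (((y ⇨ x) ⇨ z) ⇨ z) = 1

namespace BLAlgebra

theorem imp_antisymm {L : Type*} [BLAlgebra L] {x y : L} (h : x ⇨ y = 1) (h' : y ⇨ x = 1) :
    x = y := by
  have := mul_imp_comm x y
  rwa [h, h', mul_one, mul_one] at this

theorem one_imp {L : Type*} [BLAlgebra L] (x : L) : (1 : L) ⇨ x = x := by
  apply imp_antisymm
  · have := imp_imp (1 ⇨ x) 1 x
    rw [imp_self, mul_one] at this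
    exact this.symm
  · rw [imp_imp, mul_one, imp_self]

theorem imp_one {L : Type*} [BLAlgebra L] (x : L) : x ⇨ (1 : L) = 1 := by
  have h : x * (x ⇨ 1) = x := by rw [mul_imp_comm, one_imp, one_mul]
  have h2 := imp_imp (x ⇨ 1) x 1
  rw [imp_self, mul_comm, h] at h2
  exact h2.symm

theorem imp_trans {L : Type*} [BLAlgebra L] {x y z : L} (h : x ⇨ y = 1) (h' : y ⇨ z = 1) :
    x ⇨ z = 1 := by
  have hx : x = (y ⇨ x) * y := by rw [mul_comm, ← mul_imp_comm, h, mul_one]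
  rw [hx, ← imp_imp, h', imp_one]

theorem mul_imp_left {L : Type*} [BLAlgebra L] (x y : L) : (x * y) ⇨ x = 1 := by
  rw [mul_comm, ← imp_imp, imp_self, imp_one]

theorem imp_mul_imp {L : Type*} [BLAlgebra L] (x y : L) : (x * (x ⇨ y)) ⇨ y = 1 := by
  rw [mul_comm, ← imp_imp, imp_self]

theorem mul_imp_mul {L : Type*} [BLAlgebra L] {y z : L} (x : L) (h : y ⇨ z = 1) :
    (x * y) ⇨ (x * z) = 1 := by
  rw [mul_comm x y, ← imp_imp]
  refine imp_trans h ?_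
  rw [imp_imp, mul_comm x z, imp_self]

theorem imp_mono {L : Type*} [BLAlgebra L] {y z : L} (x : L) (h : y ⇨ z = 1) :
    (x ⇨ y) ⇨ (x ⇨ z) = 1 := by
  rw [imp_imp, mul_comm]
  exact imp_trans (imp_mul_imp x y) h

theorem imp_inf {L : Type*} [BLAlgebra L] {x y z : L} (h : z ⇨ x = 1) (h' : z ⇨ y = 1) :
    z ⇨ (x * (x ⇨ y)) = 1 := by
  have hz : z = x * (x ⇨ z) := by rw [mul_imp_comm, h, mul_one]
  have := mul_imp_mul x (imp_mono x h')
  rwa [← hz] at this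

theorem imp_imp_imp {L : Type*} [BLAlgebra L] (x y : L) : x ⇨ ((x ⇨ y) ⇨ y) = 1 := by
  rw [imp_imp, imp_mul_imp]

/-- The natural order of a BL-algebra is a lattice order, with
`x ⊓ y = x * (x ⇨ y)` and `x ⊔ y = ((x ⇨ y) ⇨ y) ⊓ ((y ⇨ x) ⇨ x)`. -/
instance instLattice {L : Type*} [BLAlgebra L] : Lattice L where
  le x y := x ⇨ y = 1
  le_refl := imp_self
  le_trans _ _ _ := imp_trans
  le_antisymm _ _ := imp_antisymm
  inf x y := x * (x ⇨ y)
  inf_le_left x y := mul_imp_left x _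
  inf_le_right x y := imp_mul_imp x y
  le_inf _ _ _ := imp_inf
  sup x y := ((x ⇨ y) ⇨ y) * (((x ⇨ y) ⇨ y) ⇨ ((y ⇨ x) ⇨ x))
  le_sup_left x y := imp_inf (imp_imp_imp x y) (by rw [imp_imp, mul_imp_left])
  le_sup_right x y := imp_inf (by rw [imp_imp, mul_imp_left]) (imp_imp_imp y x)
  sup_le x y z hx hy := by
    set s := ((x ⇨ y) ⇨ y) * (((x ⇨ y) ⇨ y) ⇨ ((y ⇨ x) ⇨ x)) with hs
    have h1 : (x ⇨ y) ⇨ (s ⇨ z) = 1 := by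
      rw [imp_imp, mul_comm, ← imp_imp]
      refine imp_trans (mul_imp_left _ _) ?_
      exact imp_mono _ hy
    have h2 : (y ⇨ x) ⇨ (s ⇨ z) = 1 := by
      rw [imp_imp, mul_comm, ← imp_imp]
      refine imp_trans (imp_mul_imp _ _) ?_
      exact imp_mono _ hx
    have h3 := prelinear x y (s ⇨ z)
    rwa [h1, h2, one_imp, one_imp] at h3

/-- The complement `x ⇨ 0`. -/
def neg {L : Type*} [BLAlgebra L] (x : L) : L := x ⇨ 0

/-- The pseudo-addition `x ⊘ y = neg x ⇨ y`. -/
def pseudoAdd {L : Type*} [BLAlgebra L] (x y : L) : L := neg x ⇨ y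

/-- The (commutative) addition `(x ⊘ y) ⊓ (y ⊘ x)` of a BL-algebra. -/
def add {L : Type*} [BLAlgebra L] (x y : L) : L := pseudoAdd x y ⊓ pseudoAdd y x

/-- Good sequences. The term written `a_{i+1}` in the usual one-based indexing is `a i` here. -/
def IsGood {L : Type*} [BLAlgebra L] (a : ℕ → L) : Prop :=
  (∀ i, add (a i) (a (i + 1)) = a i) ∧ ∃ n, ∀ r, n ≤ r → a r = 0

/-- The sum of two sequences. In one-based indexing its `i`-th term is
`a_i + (a_{i-1} * b_1) + ⋯ + (a_1 * b_{i-1}) + b_i`, the sum being taken from left to right with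
the addition `BLAlgebra.add`. -/
def seqAdd {L : Type*} [BLAlgebra L] (a b : ℕ → L) (n : ℕ) : L :=
  add ((List.range n).foldl (fun s j => add s (a (n - 1 - j) * b j)) (a n)) (b n)

/-- The set `M_L` of good sequences of `L`. -/
def GoodSeq (L : Type*) [BLAlgebra L] : Type _ := {a : ℕ → L // IsGood a}

theorem isGood_zero {L : Type*} [BLAlgebra L] : IsGood (fun _ : ℕ => (0 : L)) := by
  refine ⟨fun _ => ?_, 0, fun _ _ => rfl⟩
  simp only [add, pseudoAdd, neg, imp_self, one_imp, inf_idem]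

/-- The good sequence `(0)`. -/
instance instZeroGoodSeq {L : Type*} [BLAlgebra L] : Zero (GoodSeq L) := ⟨⟨_, isGood_zero⟩⟩

/-- `(a, b) ∼ (c, d)` iff `a + d + k = b + c + k` for some good sequence `k`. -/
def grothendieckRel (L : Type*) [BLAlgebra L] (p q : GoodSeq L × GoodSeq L) : Prop :=
  ∃ k : GoodSeq L,
    seqAdd (seqAdd p.1.1 q.2.1) k.1 = seqAdd (seqAdd p.2.1 q.1.1) k.1

/-- The underlying set of the Chang group `G_L`: the quotient of `M_L × M_L` by `∼`. -/
def ChangGroup (L : Type*) [BLAlgebra L] : Type _ := Quot (grothendieckRel L)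

/-- The class `[a, b]`. -/
def ChangGroup.mk {L : Type*} [BLAlgebra L] (a b : GoodSeq L) : ChangGroup L :=
  Quot.mk (grothendieckRel L) (a, b)

end BLAlgebra

/-! The order is determined by totally ordered quotients: a filter maximal among those omitting `x ⇨
y` is prime (`exists_prime_filter`), so identities and inequalities can be checked in chains
(`le_of_forall_chain`). In a chain every element is dense (`neg x = 0`) or regular (`neg (neg x) =
x`), every good sequence is some `std n x`, and the sum of two of them is governed by `add x y` and
`x * y`, where the former is `1` or the latter is `0`.

The obstacle is that addition of good sequences is in general neither associative nor cancellative,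
even in a chain. For `x ≠ 1` dense and `y` regular other than `0` and `1`, the two bracketings of
`(x) + (y) + (neg y)` are `(1, 1, 0, …)` and `(1, x, 0, …)`. Hence the auxiliary sequence `k` cannot
be handled as in a monoid, and even transitivity of `∼` is not formal.

The remedy is to replace `k` by a one-term sequence `(z)`. If `z ≠ 0` and `neg z ≠ 0`, adding `(z)`
makes dense elements indistinguishable from `1`; only double negations matter, and for regular
elements addition is associative and cancellative. If instead all entries are `0` or dense, addition
is associative, and `k` can be completed to leading ones followed by `z`, as soon as its entries
divide `z`. `exists_strict_or_dense` builds, from finitely many entries, one `z` that is of one of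
these two kinds in each chain quotient.

Consequently one `z` witnesses several comparisons at once (`StableLE.exists_single_pair`), and good
sequences modulo stable equality form an ordered cancellative monoid, whose group of differences is
the required group. Joins and meets come from coordinatewise ones because addition distributes over
them (`sup_seqAdd`, `inf_seqAdd`). -/

namespace BLAlgebra

/-! ### Residuation, negation and addition -/

section Basic

variable {L : Type*} [BLAlgebra L]

theorem le_iff_imp {x y : L} : x ≤ y ↔ x ⇨ y = 1 := Iff.rfl

theorem le_one (x : L) : x ≤ 1 := imp_one x

theorem bot_le' (x : L) : 0 ≤ x := zero_imp x

theorem le_zero_iff {x : L} : x ≤ 0 ↔ x = 0 :=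
  ⟨fun h => le_antisymm h (bot_le' x), fun h => h.le⟩

theorem one_le_iff {x : L} : 1 ≤ x ↔ x = 1 :=
  ⟨fun h => le_antisymm (le_one x) h, fun h => h.ge⟩

theorem mul_le_iff {x y z : L} : x * y ≤ z ↔ x ≤ y ⇨ z := by
  rw [le_iff_imp, le_iff_imp, imp_imp]

theorem mul_le_iff' {x y z : L} : x * y ≤ z ↔ y ≤ x ⇨ z := by
  rw [mul_comm, mul_le_iff]

theorem mul_le_mul_of_le {x x' y y' : L} (h : x ≤ x') (h' : y ≤ y') : x * y ≤ x' * y' :=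
  le_trans (mul_imp_mul x h') (by rw [mul_comm x, mul_comm x']; exact mul_imp_mul y' h)

theorem mul_le_left (x y : L) : x * y ≤ x := mul_imp_left x y

theorem mul_le_right (x y : L) : x * y ≤ y := by rw [mul_comm]; exact mul_imp_left y x

theorem zero_mul' (x : L) : 0 * x = 0 := le_zero_iff.1 (mul_le_left 0 x)

theorem mul_zero' (x : L) : x * 0 = 0 := le_zero_iff.1 (mul_le_right x 0)

theorem mul_imp_eq_of_le {x y : L} (h : y ≤ x) : x * (x ⇨ y) = y := by
  rw [mul_imp_comm, le_iff_imp.1 h, mul_one]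

theorem imp_le_imp {x x' y y' : L} (h : x' ≤ x) (h' : y ≤ y') : x ⇨ y ≤ x' ⇨ y' := by
  rw [← mul_le_iff]
  exact le_trans (mul_le_mul_of_le le_rfl h)
    (le_trans (by rw [mul_comm]; exact imp_mul_imp x y) h')

theorem le_imp (x y : L) : y ≤ x ⇨ y := mul_le_iff.1 (mul_le_left y x)

theorem neg_anti {x y : L} (h : x ≤ y) : neg y ≤ neg x := imp_le_imp h le_rfl

theorem neg_zero' : neg (0 : L) = 1 := imp_self 0

theorem neg_one' : neg (1 : L) = 0 := one_imp 0

theorem le_neg_neg (x : L) : x ≤ neg (neg x) := imp_imp_imp x 0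

theorem neg_neg_neg (x : L) : neg (neg (neg x)) = neg x :=
  le_antisymm (neg_anti (le_neg_neg x)) (le_neg_neg _)

theorem le_neg_iff {x y : L} : x ≤ neg y ↔ x * y = 0 := by
  rw [← le_zero_iff, mul_le_iff]; rfl

theorem mul_neg_self (x : L) : x * neg x = 0 := by
  rw [mul_comm]; exact le_neg_iff.1 le_rfl

theorem neg_mul' (x y : L) : neg (x * y) = x ⇨ neg y := (imp_imp x y 0).symm

theorem neg_eq_one_iff {x : L} : neg x = 1 ↔ x = 0 := by
  rw [← le_zero_iff]; rfl

theorem add_comm' (x y : L) : add x y = add y x := inf_comm _ _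

theorem add_zero' (x : L) : add x 0 = x := by
  simp only [add, pseudoAdd, neg_zero', one_imp]
  exact inf_eq_right.2 (le_neg_neg x)

theorem zero_add' (x : L) : add 0 x = x := by rw [add_comm', add_zero']

theorem add_mono {x x' y y' : L} (h : x ≤ x') (h' : y ≤ y') : add x y ≤ add x' y' :=
  inf_le_inf (imp_le_imp (neg_anti h) h') (imp_le_imp (neg_anti h') h)

theorem le_add_left' (x y : L) : x ≤ add x y := by
  simpa only [add_zero'] using add_mono (le_refl x) (bot_le' y)

theorem le_add_right' (x y : L) : y ≤ add x y := by
  rw [add_comm']; exact le_add_left' y x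

theorem one_add' (x : L) : add 1 x = 1 := one_le_iff.1 (le_add_left' 1 x)

theorem add_one' (x : L) : add x 1 = 1 := one_le_iff.1 (le_add_right' x 1)

theorem seqAdd_mono {a a' b b' : ℕ → L} (h : a ≤ a') (h' : b ≤ b') :
    seqAdd a b ≤ seqAdd a' b' := by
  intro n
  refine add_mono ?_ (h' n)
  have key : ∀ (l : List ℕ) (s s' : L), s ≤ s' →
      l.foldl (fun s j => add s (a (n - 1 - j) * b j)) s ≤
      l.foldl (fun s j => add s (a' (n - 1 - j) * b' j)) s' := by
    intro l
    induction l with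
    | nil => exact fun _ _ h => h
    | cons j l ih => exact fun s s' hs => ih _ _ (add_mono hs (mul_le_mul_of_le (h _) (h' _)))
  exact key _ _ _ (h n)

theorem seqAdd_comp {M : Type*} [BLAlgebra M] {f : L → M}
    (hadd : ∀ x y, f (add x y) = add (f x) (f y)) (hmul : ∀ x y, f (x * y) = f x * f y)
    (a b : ℕ → L) : seqAdd (f ∘ a) (f ∘ b) = f ∘ seqAdd a b := by
  funext n
  simp only [seqAdd, Function.comp_apply, hadd]
  congr 1
  have key : ∀ (l : List ℕ) (s : L),
      l.foldl (fun s j => add s (f (a (n - 1 - j)) * f (b j))) (f s) =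
      f (l.foldl (fun s j => add s (a (n - 1 - j) * b j)) s) := by
    intro l
    induction l with
    | nil => exact fun _ => rfl
    | cons j l ih => intro s; rw [List.foldl_cons, List.foldl_cons, ← ih, hadd, hmul]
  exact key _ _

theorem seqAdd_eq_zero_of_le {a b : ℕ → L} {n m : ℕ} (ha : ∀ r, n ≤ r → a r = 0)
    (hb : ∀ r, m ≤ r → b r = 0) (r : ℕ) (hr : n + m ≤ r) : seqAdd a b r = 0 := by
  have key : ∀ l : List ℕ, (∀ j ∈ l, j < r) →
      l.foldl (fun s j => add s (a (r - 1 - j) * b j)) 0 = 0 := by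
    intro l
    induction l with
    | nil => exact fun _ => rfl
    | cons j l ih =>
      intro hl
      have hj : a (r - 1 - j) * b j = 0 := by
        rcases le_or_gt m j with h | h
        · rw [hb j h, mul_zero']
        · rw [ha _ (by omega), zero_mul']
      rw [List.foldl_cons, hj, add_zero']
      exact ih fun i hi => hl i (List.mem_cons_of_mem _ hi)
  rw [seqAdd, ha r (by omega), hb r (by omega), add_zero']
  exact key _ fun j hj => List.mem_range.1 hj

/-- The sequence `(1, …, 1, x, 0, 0, …)` with `n` leading ones. -/
def std (n : ℕ) (x : L) (i : ℕ) : L := if i < n then 1 else if i = n then x else 0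

theorem isGood_std (n : ℕ) (x : L) : IsGood (std n x) := by
  refine ⟨fun i => ?_, n + 1, fun r hr => ?_⟩
  · rcases lt_or_ge i n with h | h
    · rw [std, if_pos h, one_add']
    · have : std n x (i + 1) = 0 := by rw [std, if_neg (by omega), if_neg (by omega)]
      rw [this, add_zero']
  · rw [std, if_neg (by omega), if_neg (by omega)]

end Basic

/-- Homomorphisms of BL-algebras. -/
structure Hom (L M : Type*) [BLAlgebra L] [BLAlgebra M] where
  toFun : L → M
  map_mul : ∀ x y, toFun (x * y) = toFun x * toFun y
  map_imp : ∀ x y, toFun (x ⇨ y) = toFun x ⇨ toFun y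
  map_zero : toFun 0 = 0
  map_one : toFun 1 = 1

namespace Hom

variable {L M : Type*} [BLAlgebra L] [BLAlgebra M] (f : Hom L M)

theorem mono {x y : L} (h : x ≤ y) : f.toFun x ≤ f.toFun y := by
  rw [le_iff_imp, ← f.map_imp, le_iff_imp.1 h, f.map_one]

theorem map_neg (x : L) : f.toFun (neg x) = neg (f.toFun x) := by
  rw [neg, f.map_imp, f.map_zero]; rfl

theorem map_inf (x y : L) : f.toFun (x ⊓ y) = f.toFun x ⊓ f.toFun y := by
  change f.toFun (x * (x ⇨ y)) = f.toFun x * (f.toFun x ⇨ f.toFun y)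
  rw [f.map_mul, f.map_imp]

theorem sup_eq_imp {N : Type*} [BLAlgebra N] (x y : N) :
    x ⊔ y = ((x ⇨ y) ⇨ y) ⊓ ((y ⇨ x) ⇨ x) := rfl

theorem map_sup (x y : L) : f.toFun (x ⊔ y) = f.toFun x ⊔ f.toFun y := by
  simp only [sup_eq_imp, map_inf, f.map_imp]

theorem map_add (x y : L) : f.toFun (add x y) = add (f.toFun x) (f.toFun y) := by
  simp only [add, pseudoAdd, map_inf, f.map_imp, map_neg]

theorem map_seqAdd (a b : ℕ → L) :
    f.toFun ∘ seqAdd a b = seqAdd (f.toFun ∘ a) (f.toFun ∘ b) :=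
  (seqAdd_comp f.map_add f.map_mul a b).symm

theorem isGood_comp {a : ℕ → L} (ha : IsGood a) : IsGood (f.toFun ∘ a) := by
  obtain ⟨h, n, hn⟩ := ha
  refine ⟨fun i => ?_, n, fun r hr => ?_⟩
  · rw [Function.comp_apply, Function.comp_apply, ← f.map_add, h]
  · rw [Function.comp_apply, hn r hr, f.map_zero]

end Hom

/-- Totally ordered BL-algebras. -/
class Chain (C : Type*) extends BLAlgebra C where
  total : ∀ x y : C, x ⇨ y = 1 ∨ y ⇨ x = 1

/-! ### Prime filters and quotients -/

section Filter

variable {L : Type*} [BLAlgebra L]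

/-- Filters of a BL-algebra. -/
structure IsFilter (F : Set L) : Prop where
  one_mem : (1 : L) ∈ F
  mul_mem : ∀ {x y}, x ∈ F → y ∈ F → x * y ∈ F
  mem_of_le : ∀ {x y}, x ∈ F → x ≤ y → y ∈ F

/-- `p` and `q` have join `1`. -/
def Coprime (p q : L) : Prop := ∀ z, p ≤ z → q ≤ z → z = 1

theorem coprime_imp (x y : L) : Coprime (x ⇨ y) (y ⇨ x) := by
  intro z h h'
  have := prelinear x y z
  rwa [le_iff_imp.1 h, le_iff_imp.1 h', one_imp, one_imp] at this

theorem Coprime.symm {p q : L} (h : Coprime p q) : Coprime q p := fun z h1 h2 => h z h2 h1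

/-- From `p * p' ≤ z` follows `p ≤ p' ⇨ z`, and also `q ≤ z ≤ p' ⇨ z`; so coprimality of `p` and `q`
gives `p' ≤ z`, and that of `p'` and `q` finishes. -/
theorem Coprime.mul {p p' q : L} (h : Coprime p q) (h' : Coprime p' q) :
    Coprime (p * p') q := by
  intro z h1 h2
  refine h' z ?_ h2
  exact h _ (mul_le_iff.1 h1) (le_trans h2 (le_imp _ _))

theorem Coprime.pow_left {p q : L} (h : Coprime p q) (n : ℕ) : Coprime (p ^ n) q := by
  induction n with
  | zero => intro z h1 _; rw [pow_zero] at h1; exact one_le_iff.1 h1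
  | succ n ih => rw [pow_succ]; exact ih.mul h

theorem isFilter_adjoin {F : Set L} (hF : IsFilter F) (p : L) :
    IsFilter {x | ∃ f ∈ F, ∃ n : ℕ, f * p ^ n ≤ x} where
  one_mem := ⟨1, hF.one_mem, 0, le_one _⟩
  mul_mem := by
    rintro x y ⟨f, hf, n, h⟩ ⟨g, hg, m, h'⟩
    refine ⟨f * g, hF.mul_mem hf hg, n + m, ?_⟩
    rw [pow_add, mul_mul_mul_comm]
    exact mul_le_mul_of_le h h'
  mem_of_le := by
    rintro x y ⟨f, hf, n, h⟩ hxy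
    exact ⟨f, hf, n, le_trans h hxy⟩

/-- Zorn gives a filter maximal among those omitting `d`. Were both implications outside it,
adjoining either would capture `d` through a power; powers of the two implications stay coprime, so
`d` would already be in the filter. -/
theorem exists_prime_filter {d : L} (hd : d ≠ 1) :
    ∃ F : Set L, IsFilter F ∧ d ∉ F ∧ ∀ x y : L, x ⇨ y ∈ F ∨ y ⇨ x ∈ F := by
  obtain ⟨F, -, ⟨hF, hdF⟩, hmax⟩ := zorn_subset_nonempty {F : Set L | IsFilter F ∧ d ∉ F} (by
    intro c hc hchain hne
    obtain ⟨F₀, hF₀⟩ := hne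
    refine ⟨⋃₀ c, ⟨⟨⟨F₀, hF₀, (hc hF₀).1.one_mem⟩, ?_, ?_⟩, ?_⟩, fun s hs => Set.subset_sUnion_of_mem hs⟩
    · rintro x y ⟨F, hF, hx⟩ ⟨G, hG, hy⟩
      rcases hchain.total hF hG with h | h
      · exact ⟨G, hG, (hc hG).1.mul_mem (h hx) hy⟩
      · exact ⟨F, hF, (hc hF).1.mul_mem hx (h hy)⟩
    · rintro x y ⟨F, hF, hx⟩ hxy
      exact ⟨F, hF, (hc hF).1.mem_of_le hx hxy⟩
    · rintro ⟨F, hF, hx⟩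
      exact (hc hF).2 hx) {1} ⟨⟨rfl, by rintro x y rfl rfl; exact mul_one _, by
        rintro x y rfl h; exact one_le_iff.1 h⟩, hd⟩
  have key : ∀ p, p ∉ F → ∃ f ∈ F, ∃ n : ℕ, f * p ^ n ≤ d := by
    intro p hp
    by_contra hcon
    have hsub : F ⊆ {x | ∃ f ∈ F, ∃ n : ℕ, f * p ^ n ≤ x} := fun x hx =>
      ⟨x, hx, 0, mul_le_left _ _⟩
    refine hp (hmax ⟨isFilter_adjoin hF p, hcon⟩ hsub ⟨1, hF.one_mem, 1, ?_⟩)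
    rw [one_mul, pow_one]
  refine ⟨F, hF, hdF, fun x y => ?_⟩
  by_contra! hcon
  obtain ⟨f, hf, n, hn⟩ := key _ hcon.1
  obtain ⟨g, hg, m, hm⟩ := key _ hcon.2
  have hco := ((coprime_imp x y).pow_left n).symm.pow_left m |>.symm
  have h1 := hco ((f * g) ⇨ d)
    (mul_le_iff'.1 (le_trans (mul_le_mul_of_le (mul_le_left f g) le_rfl) hn))
    (mul_le_iff'.1 (le_trans (mul_le_mul_of_le (mul_le_right f g) le_rfl) hm))
  exact hdF (hF.mem_of_le (hF.mul_mem hf hg) h1)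

theorem imp_le_mul_imp_mul (x y z : L) : x ⇨ y ≤ (z * x) ⇨ (z * y) := by
  rw [← mul_le_iff, mul_left_comm]
  exact mul_le_mul_of_le le_rfl (by rw [mul_comm]; exact imp_mul_imp x y)

theorem imp_mul_imp_le (x y z : L) : (x ⇨ y) * (y ⇨ z) ≤ x ⇨ z := by
  rw [← mul_le_iff, mul_right_comm, mul_comm _ x]
  exact le_trans (mul_le_mul_of_le (imp_mul_imp x y) le_rfl) (imp_mul_imp y z)

theorem imp_le_imp_imp_imp (x y z : L) : x ⇨ y ≤ (y ⇨ z) ⇨ (x ⇨ z) :=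
  mul_le_iff.1 (imp_mul_imp_le x y z)

theorem imp_le_imp_imp_imp' (x y z : L) : x ⇨ y ≤ (z ⇨ x) ⇨ (z ⇨ y) :=
  mul_le_iff'.1 (imp_mul_imp_le z x y)

/-- The congruence of a filter. -/
def filterSetoid {F : Set L} (hF : IsFilter F) : Setoid L where
  r x y := x ⇨ y ∈ F ∧ y ⇨ x ∈ F
  iseqv := by
    refine ⟨fun x => ?_, fun h => ⟨h.2, h.1⟩, fun {x y z} h h' => ⟨?_, ?_⟩⟩
    · rw [imp_self]; exact ⟨hF.one_mem, hF.one_mem⟩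
    · exact hF.mem_of_le (hF.mul_mem h.1 h'.1) (imp_mul_imp_le x y z)
    · exact hF.mem_of_le (hF.mul_mem h'.2 h.2) (imp_mul_imp_le z y x)

/-- The quotient of a BL-algebra by a filter. -/
def FilterQuotient {F : Set L} (hF : IsFilter F) : Type _ := Quotient (filterSetoid hF)

instance {F : Set L} (hF : IsFilter F) : BLAlgebra (FilterQuotient hF) where
  mul := Quotient.map₂ (· * ·) (by
    intro x x' h y y' h'
    have aux : ∀ {x x' y y' : L}, x ⇨ x' ∈ F → y ⇨ y' ∈ F → (x * y) ⇨ (x' * y') ∈ F := by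
      intro x x' y y' h h'
      refine hF.mem_of_le (hF.mul_mem (hF.mem_of_le h (imp_le_mul_imp_mul x x' y))
        (hF.mem_of_le h' (imp_le_mul_imp_mul y y' x'))) ?_
      rw [mul_comm y x, mul_comm y x']
      exact imp_mul_imp_le _ _ _
    exact ⟨aux h.1 h'.1, aux h.2 h'.2⟩)
  himp := Quotient.map₂ (· ⇨ ·) (by
    intro x x' h y y' h'
    have aux : ∀ {x x' y y' : L}, x' ⇨ x ∈ F → y ⇨ y' ∈ F → (x ⇨ y) ⇨ (x' ⇨ y') ∈ F := by
      intro x x' y y' h h'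
      exact hF.mem_of_le (hF.mul_mem (hF.mem_of_le h (imp_le_imp_imp_imp x' x y))
        (hF.mem_of_le h' (imp_le_imp_imp_imp' y y' x'))) (imp_mul_imp_le _ _ _)
    exact ⟨aux h.2 h'.1, aux h.1 h'.2⟩)
  one := Quotient.mk _ 1
  zero := Quotient.mk _ 0
  mul_assoc := by
    rintro ⟨x⟩ ⟨y⟩ ⟨z⟩; exact congrArg (Quotient.mk _) (mul_assoc x y z)
  one_mul := by rintro ⟨x⟩; exact congrArg (Quotient.mk _) (one_mul x)
  mul_one := by rintro ⟨x⟩; exact congrArg (Quotient.mk _) (mul_one x)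
  mul_comm := by rintro ⟨x⟩ ⟨y⟩; exact congrArg (Quotient.mk _) (mul_comm x y)
  imp_self := by rintro ⟨x⟩; exact congrArg (Quotient.mk _) (imp_self x)
  mul_imp_comm := by rintro ⟨x⟩ ⟨y⟩; exact congrArg (Quotient.mk _) (mul_imp_comm x y)
  imp_imp := by rintro ⟨x⟩ ⟨y⟩ ⟨z⟩; exact congrArg (Quotient.mk _) (imp_imp x y z)
  zero_imp := by rintro ⟨x⟩; exact congrArg (Quotient.mk _) (zero_imp x)
  prelinear := by rintro ⟨x⟩ ⟨y⟩ ⟨z⟩; exact congrArg (Quotient.mk _) (prelinear x y z)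

/-- The projection onto the quotient by a filter. -/
def FilterQuotient.proj {F : Set L} (hF : IsFilter F) : Hom L (FilterQuotient hF) where
  toFun := Quotient.mk _
  map_mul _ _ := rfl
  map_imp _ _ := rfl
  map_zero := rfl
  map_one := rfl

theorem FilterQuotient.proj_eq_one_iff {F : Set L} (hF : IsFilter F) (x : L) :
    (FilterQuotient.proj hF).toFun x = 1 ↔ x ∈ F := by
  refine Iff.trans (Quotient.eq (r := filterSetoid hF)) ?_
  change (x ⇨ 1 ∈ F ∧ 1 ⇨ x ∈ F) ↔ _
  rw [one_imp, imp_one]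
  exact and_iff_right hF.one_mem

end Filter

/-- The order of a BL-algebra is determined by its totally ordered quotients. -/
theorem le_of_forall_chain.{u} {L : Type u} [BLAlgebra L] {x y : L}
    (h : ∀ (C : Type u) [Chain C] (f : Hom L C), f.toFun x ≤ f.toFun y) : x ≤ y := by
  by_contra hxy
  obtain ⟨F, hF, hd, hprime⟩ := exists_prime_filter (d := x ⇨ y) hxy
  let _ : Chain (FilterQuotient hF) :=
    { (inferInstance : BLAlgebra (FilterQuotient hF)) with
      total := by
        rintro ⟨a⟩ ⟨b⟩
        exact (hprime a b).imp (FilterQuotient.proj_eq_one_iff hF _).2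
          (FilterQuotient.proj_eq_one_iff hF _).2 }
  have := h (FilterQuotient hF) (FilterQuotient.proj hF)
  rw [le_iff_imp, ← (FilterQuotient.proj hF).map_imp] at this
  exact hd ((FilterQuotient.proj_eq_one_iff hF _).1 this)

theorem eq_of_forall_chain.{u} {L : Type u} [BLAlgebra L] {x y : L}
    (h : ∀ (C : Type u) [Chain C] (f : Hom L C), f.toFun x = f.toFun y) : x = y :=
  le_antisymm (le_of_forall_chain fun C _ f => (h C f).le)
    (le_of_forall_chain fun C _ f => (h C f).ge)

/-! ### Arithmetic of chains: dense and regular elements -/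

namespace Chain

variable {C : Type*} [Chain C]

theorem le_total' (x y : C) : x ≤ y ∨ y ≤ x := total x y

theorem inf_eq_or (x y : C) : x ⊓ y = x ∨ x ⊓ y = y :=
  (le_total' x y).imp inf_eq_left.2 inf_eq_right.2

theorem sup_eq_or (x y : C) : x ⊔ y = x ∨ x ⊔ y = y :=
  (le_total' y x).imp sup_eq_left.2 sup_eq_right.2

/-- If `s ⇨ p = p ≠ 1`, then `s` acts trivially on `p`. -/
theorem mul_eq_of_imp_eq {s p : C} (hp : p ≠ 1) (h : s ⇨ p = p) : s * p = p := by
  rcases le_total' s p with h' | h'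
  · exact absurd (h.symm.trans h') hp
  · simpa only [h] using mul_imp_eq_of_le h'

/-- An element of a chain is dense or regular. -/
theorem neg_eq_zero_or (x : C) : neg x = 0 ∨ neg (neg x) = x := by
  by_contra! hcon
  obtain ⟨h0, h1⟩ := hcon
  set t := neg (neg x) with ht
  have hxt : x ≤ t := le_neg_neg x
  set s := t ⇨ x with hs
  have hx : t * s = x := mul_imp_eq_of_le hxt
  -- Since `x = t * s`, the element `s` fixes `neg x` under `⇨`, hence under multiplication;
  -- negating, it fixes `t` in the same two ways, so `x = t * s = t`.
  have hp : s ⇨ neg x = neg x := by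
    rw [← neg_neg_neg x, ← ht, ← neg_mul', mul_comm, hx, ht, neg_neg_neg]
  have hne : neg x ≠ 1 := by
    intro h
    rw [neg_eq_one_iff] at h
    exact h1 (by rw [ht, h, neg_zero', neg_one'])
  have hsp := mul_eq_of_imp_eq hne hp
  have hst : s ⇨ t = t := by
    conv_rhs => rw [ht, ← hsp, neg_mul']
  have hne' : t ≠ 1 := fun h => h0 (neg_eq_one_iff.1 h)
  have := mul_eq_of_imp_eq hne' hst
  rw [mul_comm, hx] at this
  exact h1 this.symm

theorem neg_neg_of_ne {x : C} (h : neg x ≠ 0) : neg (neg x) = x :=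
  (neg_eq_zero_or x).resolve_left h

theorem neg_inj {x y : C} (hx : neg x ≠ 0) (h : neg x = neg y) : x = y := by
  rw [← neg_neg_of_ne hx, h, neg_neg_of_ne (h ▸ hx)]

theorem dense_mul {x y : C} (hx : neg x = 0) (hy : neg y = 0) : neg (x * y) = 0 := by
  rw [neg_mul', hy]; exact hx

/-- Both sides have the same negation, and negation is injective on elements that are not dense. -/
theorem dense_mul_eq {w v : C} (hw : neg w = 0) (hv : neg v ≠ 0) : w * v = v := by
  refine (neg_inj hv ?_).symm
  rw [mul_comm, neg_mul', hw]; rfl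

theorem dense_add {w v : C} (hw : neg w = 0) (hv : v ≠ 0) : add w v = 1 := by
  have h1 : pseudoAdd w v = 1 := by rw [pseudoAdd, hw, zero_imp]
  have h2 : pseudoAdd v w = 1 := by
    change neg v ≤ w
    rcases le_total' (neg v) w with h | h
    · exact h
    · have := neg_anti h
      rw [hw] at this
      exact absurd (le_zero_iff.1 ((le_neg_neg v).trans this)) hv
  rw [add, h1, h2, inf_idem]

theorem add_regular {x y : C} (hx : neg (neg x) = x) (hy : neg (neg y) = y) :
    add x y = neg x ⇨ y := by
  have : neg y ⇨ x = neg x ⇨ y := by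
    conv_lhs => rw [← hx]
    conv_rhs => rw [← hy]
    rw [← neg_mul', ← neg_mul', mul_comm]
  rw [add, pseudoAdd, pseudoAdd, this, inf_idem]

theorem neg_add_regular {x y : C} (hx : neg (neg x) = x) (hy : neg (neg y) = y) :
    add x y = neg (neg x * neg y) := by
  rw [add_regular hx hy, neg_mul', hy]

theorem regular_add {x y : C} (hx : neg (neg x) = x) (hy : neg (neg y) = y) :
    neg (neg (add x y)) = add x y := by
  rw [neg_add_regular hx hy, neg_neg_neg]

theorem regular_eq_one {x : C} (hx : neg (neg x) = x) (h : neg x = 0) : x = 1 := by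
  rw [← hx, h, neg_zero']

theorem regular_mul {x y : C} (hx : neg (neg x) = x) (hy : neg (neg y) = y) :
    neg (neg (x * y)) = x * y := by
  rcases neg_eq_zero_or (x * y) with h | h
  · have h1 : x = 1 := regular_eq_one hx (le_zero_iff.1 (h ▸ neg_anti (mul_le_left x y)))
    have h2 : y = 1 := regular_eq_one hy (le_zero_iff.1 (h ▸ neg_anti (mul_le_right x y)))
    rw [h1, h2, mul_one, neg_one', neg_zero']
  · exact h

theorem neg_neg_mul (x y : C) : neg (neg (x * y)) = neg (neg x) * neg (neg y) := by
  have aux : ∀ x y : C, neg x = 0 → neg (neg (x * y)) = neg (neg x) * neg (neg y) := by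
    intro x y hx
    rw [hx, neg_zero', one_mul]
    by_cases hy : neg y = 0
    · rw [dense_mul hx hy, hy]
    · rw [dense_mul_eq hx hy]
  rcases neg_eq_zero_or x with hx | hx
  · exact aux x y hx
  rcases neg_eq_zero_or y with hy | hy
  · rw [mul_comm, aux y x hy, mul_comm]
  · rw [regular_mul hx hy, hx, hy]

theorem neg_neg_add (x y : C) : neg (neg (add x y)) = add (neg (neg x)) (neg (neg y)) := by
  have aux : ∀ x y : C, neg x = 0 → neg (neg (add x y)) = add (neg (neg x)) (neg (neg y)) := by
    intro x y hx
    rw [hx, neg_zero', one_add']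
    by_cases hy : y = 0
    · rw [hy, add_zero', hx, neg_zero']
    · rw [dense_add hx hy, neg_one', neg_zero']
  rcases neg_eq_zero_or x with hx | hx
  · exact aux x y hx
  rcases neg_eq_zero_or y with hy | hy
  · rw [add_comm', aux y x hy, add_comm']
  · rw [regular_add hx hy, hx, hy]

/-- For regular elements the alternatives are `neg x ≤ y` and `y ≤ neg x`; a dense element plus a
nonzero one is always `1`. -/
theorem add_eq_one_or_mul_eq_zero (x y : C) : add x y = 1 ∨ x * y = 0 := by
  have aux : ∀ x y : C, neg x = 0 → add x y = 1 ∨ x * y = 0 := by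
    intro x y hx
    by_cases hy : y = 0
    · rw [hy, mul_zero']; exact Or.inr rfl
    · exact Or.inl (dense_add hx hy)
  rcases neg_eq_zero_or x with hx | hx
  · exact aux x y hx
  rcases neg_eq_zero_or y with hy | hy
  · rw [add_comm', mul_comm]; exact aux y x hy
  · rw [add_regular hx hy]
    rcases le_total' (neg x) y with h | h
    · exact Or.inl h
    · right
      rw [mul_comm]
      exact le_neg_iff.1 h

/-- Apart from zeros, a dense summand makes either side `1`; among regular elements `add x y` is
`neg (neg x * neg y)`. -/
theorem add_assoc' (x y z : C) : add (add x y) z = add x (add y z) := by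
  have hne : ∀ {x y : C}, x ≠ 0 → add x y ≠ 0 := fun {x y} hx h =>
    hx (le_zero_iff.1 (h ▸ le_add_left' x y))
  have hne' : ∀ {x y : C}, y ≠ 0 → add x y ≠ 0 := fun {x y} hx h =>
    hx (le_zero_iff.1 (h ▸ le_add_right' x y))
  by_cases hx0 : x = 0
  · rw [hx0, zero_add', zero_add']
  by_cases hy0 : y = 0
  · rw [hy0, zero_add', add_zero']
  by_cases hz0 : z = 0
  · rw [hz0, add_zero', add_zero']
  rcases neg_eq_zero_or x with hx | hx
  · rw [dense_add hx hy0, one_add', dense_add hx (hne hy0)]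
  rcases neg_eq_zero_or y with hy | hy
  · rw [add_comm' x, dense_add hy hx0, dense_add hy hz0, one_add', add_one']
  rcases neg_eq_zero_or z with hz | hz
  · rw [add_comm' _ z, add_comm' y z, dense_add hz (hne hx0), dense_add hz hy0, add_one']
  rw [add_regular (regular_add hx hy) hz, neg_add_regular hx hy,
    regular_mul ((neg_neg_neg x)) (neg_neg_neg y), add_regular hx (regular_add hy hz),
    add_regular hy hz, imp_imp]

/-- The additive monoid of a chain. -/
abbrev addCommMonoid : AddCommMonoid C where
  add := add
  add_assoc := add_assoc'
  zero_add := zero_add'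
  add_zero := add_zero'
  add_comm := add_comm'
  nsmul := @nsmulRec C ⟨0⟩ ⟨add⟩

/-- The sequence `(1, …, 1, x, y, 0, 0, …)` with `n` leading ones. -/
def std₂ (n : ℕ) (x y : C) (i : ℕ) : C :=
  if i < n then 1 else if i = n then x else if i = n + 1 then y else 0

theorem std_succ_zero (n : ℕ) : std (n + 1) (0 : C) = std n 1 := by
  funext i
  simp only [std]
  split_ifs <;> first | rfl | omega

theorem std₂_zero (n : ℕ) (x : C) : std₂ n x 0 = std n x := by
  funext i
  simp only [std, std₂]
  split_ifs <;> rfl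

theorem std₂_one (n : ℕ) (x : C) : std₂ n 1 x = std (n + 1) x := by
  funext i
  simp only [std, std₂]
  split_ifs <;> first | rfl | omega

theorem std_zero_zero : std 0 (0 : C) = 0 := by
  funext i
  simp only [std]
  split_ifs <;> first | rfl | omega

/-! ### Sums of sequences in a chain as convolutions -/

section
open Finset
attribute [local instance] addCommMonoid

/-- With a term `1` put in front of each sequence, the sum is an ordinary convolution; `a n` and `b
n` are the products with that leading `1`. -/
theorem seqAdd_eq_sum (a b : ℕ → C) (n : ℕ) :
    seqAdd a b n = ∑ j ∈ range (n + 2),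
      Nat.casesOn (motive := fun _ => C) (n + 1 - j) 1 a *
      Nat.casesOn (motive := fun _ => C) j 1 b := by
  rw [sum_range_succ, sum_range_succ']
  have key : ∀ m ≤ n, (List.range m).foldl (fun s j => add s (a (n - 1 - j) * b j)) (a n) =
      ∑ j ∈ range m, a (n - 1 - j) * b j + a n := by
    intro m hm
    induction m with
    | zero => simp
    | succ m ih =>
      rw [List.range_succ, List.foldl_append, ih (by omega), sum_range_succ, add_right_comm]
      rfl
  rw [seqAdd, key n le_rfl]
  change (_ : C) + (_ : C) + _ = _
  congr 1
  · congr 1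
    · refine sum_congr rfl fun j hj => ?_
      have : n + 1 - (j + 1) = (n - 1 - j) + 1 := by have := mem_range.1 hj; omega
      rw [this]
    · exact (mul_one _).symm
  · rw [Nat.sub_self]; exact (one_mul _).symm

theorem eq_one_of_mem_sum {ι : Type*} (s : Finset ι) (f : ι → C) {j : ι} (hj : j ∈ s)
    (h : f j = 1) : ∑ i ∈ s, f i = 1 := by
  classical
  rw [← add_sum_erase s f hj, h]
  exact one_add' _

theorem casesOn_std (n : ℕ) (x : C) (k : ℕ) :
    Nat.casesOn (motive := fun _ => C) k 1 (std n x) =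
      if k ≤ n then 1 else if k = n + 1 then x else 0 := by
  cases k with
  | zero => simp
  | succ k => simp only [std, Nat.succ_le_iff, add_left_inj]

/-- Below index `n + m` the convolution contains a product `1 * 1`, which absorbs the rest. At `n +
m` only `x * 1` and `1 * y` survive, at `n + m + 1` only `x * y`. -/
theorem seqAdd_std (n m : ℕ) (x y : C) :
    seqAdd (std n x) (std m y) = std₂ (n + m) (add x y) (x * y) := by
  funext i
  rw [seqAdd_eq_sum]
  simp only [casesOn_std]
  rcases lt_trichotomy i (n + m) with hi | hi | hi
  · rw [eq_one_of_mem_sum (j := min m (i + 1)) _ _ (mem_range.2 (by omega))]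
    · rw [std₂, if_pos hi]
    · rw [if_pos (by omega), if_pos (by omega), one_mul]
  · have h0 : ∀ j ∈ range (i + 2), j ∉ ({m, m + 1} : Finset ℕ) →
        ((if i + 1 - j ≤ n then 1 else if i + 1 - j = n + 1 then x else 0) *
          if j ≤ m then 1 else if j = m + 1 then y else 0) = 0 := by
      intro j _ hj
      simp only [mem_insert, mem_singleton, not_or] at hj
      rcases lt_or_gt_of_ne hj.1 with h | h
      · rw [if_neg (by omega), if_neg (by omega), zero_mul']
      · rw [if_neg (show ¬ j ≤ m by omega), if_neg (show ¬ j = m + 1 by omega), mul_zero']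
    rw [← sum_subset (s₁ := {m, m + 1}) (by
      intro j hj
      simp only [mem_insert, mem_singleton] at hj
      exact mem_range.2 (by omega)) h0, sum_pair (by omega)]
    rw [if_neg (by omega), if_pos (by omega), if_pos (by omega), if_pos (by omega),
      if_neg (by omega), if_pos (by omega), mul_one, one_mul, std₂, if_neg (by omega), if_pos hi]
    rfl
  · rw [sum_eq_single (m + 1)]
    · by_cases h : i = n + m + 1
      · rw [if_neg (by omega), if_pos (by omega), if_neg (by omega), if_pos rfl, std₂,
          if_neg (by omega), if_neg (by omega), if_pos h]
      · rw [if_neg (by omega), if_neg (by omega), zero_mul', std₂,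
          if_neg (by omega), if_neg (by omega), if_neg h]
    · intro j _ hj
      rcases lt_or_gt_of_ne hj with h | h
      · rw [if_neg (by omega), if_neg (by omega), zero_mul']
      · rw [if_neg (show ¬ j ≤ m by omega), if_neg (show ¬ j = m + 1 by omega), mul_zero']
    · intro h
      exact absurd (mem_range.2 (by omega)) h

end

/-! ### Good sequences of a chain -/

/-- In the decisive case both elements are regular and `x * y = 0`, so `y ≤ neg x` and `y = neg x *
add x y = neg x * x = 0`. -/
theorem eq_one_or_of_add_eq {x y : C} (h : add x y = x) : x = 1 ∨ y = 0 := by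
  by_contra! hcon
  obtain ⟨hx, hy⟩ := hcon
  rcases neg_eq_zero_or x with hx' | hx'
  · exact hx (h ▸ dense_add hx' hy)
  have hx0 : x ≠ 0 := fun h0 => hy (by rwa [h0, zero_add'] at h)
  rcases neg_eq_zero_or y with hy' | hy'
  · exact hx (by rw [← h, add_comm', dense_add hy' hx0])
  have h0 : x * y = 0 := (add_eq_one_or_mul_eq_zero x y).resolve_left fun h' => hx (h.symm.trans h')
  have hle : y ≤ neg x := le_neg_iff.2 (by rw [mul_comm, h0])
  have := mul_imp_eq_of_le hle
  rw [← add_regular hx' hy', h, mul_comm, mul_neg_self] at this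
  exact hy this.symm

theorem eq_of_zero_eq_one (h : (0 : C) = 1) (x y : C) : x = y := by
  rw [le_zero_iff.1 ((le_one x).trans h.ge), le_zero_iff.1 ((le_one y).trans h.ge)]

theorem exists_std {a : ℕ → C} (ha : IsGood a) : ∃ n x, a = std n x := by
  obtain ⟨h, N, hN⟩ := ha
  replace h : ∀ i, a i = 1 ∨ a (i + 1) = 0 := fun i => eq_one_or_of_add_eq (h i)
  induction N generalizing a with
  | zero => exact ⟨0, 0, by rw [std_zero_zero]; funext i; exact hN i (Nat.zero_le i)⟩
  | succ N ih =>
    obtain ⟨n, x, hx⟩ := ih (a := fun i => a (i + 1)) 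
      (fun r hr => hN (r + 1) (Nat.succ_le_succ hr)) fun i => h (i + 1)
    rcases h 0 with h0 | h0
    · refine ⟨n + 1, x, funext fun i => ?_⟩
      cases i with
      | zero => rw [h0, std, if_pos (Nat.succ_pos n)]
      | succ i => rw [congrFun hx i]; simp only [std, Nat.add_lt_add_iff_right, add_left_inj]
    · have hz : ∀ i, a (i + 1) = 0 := by
        intro i
        induction i with
        | zero => exact h0
        | succ i ih' =>
          -- A term equal to both `0` and `1` is possible only in the trivial algebra, which counts
          -- as a chain.
          rcases h (i + 1) with h1 | h1
          · exact eq_of_zero_eq_one (ih'.symm.trans h1) _ _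
          · exact h1
      refine ⟨0, a 0, funext fun i => ?_⟩
      cases i with
      | zero => rfl
      | succ i => rw [hz, std, if_neg (by omega), if_neg (by omega)]

theorem seqAdd_std_of_add_eq {x y : C} (h : add x y = 1) (n m : ℕ) :
    seqAdd (std n x) (std m y) = std (n + m + 1) (x * y) := by
  rw [seqAdd_std, h, std₂_one]

theorem seqAdd_std_of_mul_eq {x y : C} (h : x * y = 0) (n m : ℕ) :
    seqAdd (std n x) (std m y) = std (n + m) (add x y) := by
  rw [seqAdd_std, h, std₂_zero]

theorem isGood_seqAdd {a b : ℕ → C} (ha : IsGood a) (hb : IsGood b) : IsGood (seqAdd a b) := by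
  obtain ⟨n, x, rfl⟩ := exists_std ha
  obtain ⟨m, y, rfl⟩ := exists_std hb
  rcases add_eq_one_or_mul_eq_zero x y with h | h
  · rw [seqAdd_std_of_add_eq h]; exact isGood_std _ _
  · rw [seqAdd_std_of_mul_eq h]; exact isGood_std _ _

theorem seqAdd_comm {a b : ℕ → C} (ha : IsGood a) (hb : IsGood b) :
    seqAdd a b = seqAdd b a := by
  obtain ⟨n, x, rfl⟩ := exists_std ha
  obtain ⟨m, y, rfl⟩ := exists_std hb
  rw [seqAdd_std, seqAdd_std, Nat.add_comm, add_comm', mul_comm]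

theorem seqAdd_zero {a : ℕ → C} (ha : IsGood a) : seqAdd a 0 = a := by
  obtain ⟨n, x, rfl⟩ := exists_std ha
  rw [← std_zero_zero, seqAdd_std_of_mul_eq (mul_zero' x), add_zero']; rfl

theorem zero_seqAdd {a : ℕ → C} (ha : IsGood a) : seqAdd 0 a = a := by
  rw [seqAdd_comm (a := 0) isGood_zero ha, seqAdd_zero ha]

theorem std_le_std_of_lt {n m : ℕ} (h : n < m) (x y : C) : std n x ≤ std m y := by
  intro i
  by_cases hi : i < m
  · simp only [std, if_pos hi]; exact le_one _
  · rw [std, if_neg (by omega), if_neg (by omega)]; exact bot_le' _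

theorem std_mono (n : ℕ) {x y : C} (h : x ≤ y) : std n x ≤ std n y := by
  intro i
  simp only [std]
  split_ifs
  exacts [le_rfl, h, le_rfl]

theorem IsGood.le_total {a b : ℕ → C} (ha : IsGood a) (hb : IsGood b) : a ≤ b ∨ b ≤ a := by
  obtain ⟨n, x, rfl⟩ := exists_std ha
  obtain ⟨m, y, rfl⟩ := exists_std hb
  rcases lt_trichotomy n m with h | rfl | h
  · exact Or.inl (std_le_std_of_lt h x y)
  · exact (le_total' x y).imp (std_mono n) (std_mono n)
  · exact Or.inr (std_le_std_of_lt h y x)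

/-! ### Regular elements -/

/-- Here `x` and `z` lie below `neg y`, so by divisibility both sides equal `neg y * (neg y ⇨ x) *
(neg y ⇨ z)`. -/
theorem add_mul_eq_mul_add {x y z : C} (hx : neg (neg x) = x) (hy : neg (neg y) = y)
    (hz : neg (neg z) = z) (hxy : x * y = 0) (hyz : y * z = 0) :
    add x y * z = x * add y z := by
  have h1 : x ≤ neg y := le_neg_iff.2 hxy
  have h2 : z ≤ neg y := le_neg_iff.2 (by rw [mul_comm, hyz])
  rw [add_comm', add_regular hy hx, add_regular hy hz]
  conv_lhs => rw [← mul_imp_eq_of_le h2]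
  conv_rhs => rw [← mul_imp_eq_of_le h1]
  rw [← mul_assoc, mul_comm (neg y ⇨ x)]

theorem neg_le_of_add_eq_one {x y : C} (hx : neg (neg x) = x) (hy : neg (neg y) = y)
    (h : add x y = 1) : neg x ≤ y := by
  rwa [add_regular hx hy] at h

theorem imp_mul_eq_of_neg_le {d q : C} (hd : neg (neg d) = d) (hq : neg (neg q) = q)
    (h : neg d ≤ q) : d ⇨ d * q = q := by
  have hdq := regular_mul hd hq
  have h' : neg q ≤ d := hd ▸ neg_anti h
  rw [← hdq, ← neg_mul', neg_mul' d q, mul_imp_eq_of_le h', hq]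

/-- Write `d = neg (x * y)` and `q` for the right-hand side. Divisibility gives `d * q = z`, so the
left-hand side is `d ⇨ d * q`, which is `q` because `neg d ≤ q`. -/
theorem mul_add_eq_mul_add {x y z : C} (hx : neg (neg x) = x) (hy : neg (neg y) = y)
    (hz : neg (neg z) = z) (hxy : add x y = 1) (hyz : y * z = 0) :
    add (x * y) z = x * add y z := by
  have hzc : z ≤ neg y := le_neg_iff.2 (by rw [mul_comm, hyz])
  have hcx : neg y ≤ x := neg_le_of_add_eq_one hy hx (by rwa [add_comm'])
  have hneg : neg (x * y) = x ⇨ neg y := neg_mul' x y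
  rw [add_regular (regular_mul hx hy) hz, hneg, add_regular hy hz]
  set q := x * (neg y ⇨ z) with hq
  have hz' : (x ⇨ neg y) * q = z := by
    rw [hq, ← mul_assoc, mul_comm _ x, mul_imp_eq_of_le hcx, mul_imp_eq_of_le hzc]
  conv_lhs => rw [← hz']
  rw [← hneg]
  refine imp_mul_eq_of_neg_le (neg_neg_neg _) ?_ ?_
  · rw [hq, ← add_regular hy hz]
    exact regular_mul hx (regular_add hy hz)
  · rw [regular_mul hx hy, hq, ← add_regular hy hz]
    exact mul_le_mul_of_le le_rfl (le_add_left' y z)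

/-- The De Morgan dual of `add_mul_eq_mul_add`, applied to the negations. -/
theorem mul_add_eq_add_mul {x y z : C} (hx : neg (neg x) = x) (hy : neg (neg y) = y)
    (hz : neg (neg z) = z) (hxy : add x y = 1) (hyz : add y z = 1) :
    add (x * y) z = add x (y * z) := by
  have h := add_mul_eq_mul_add (neg_neg_neg x) (neg_neg_neg y) (neg_neg_neg z)
    (le_neg_iff.1 (by rw [hy]; exact neg_le_of_add_eq_one hx hy hxy))
    (le_neg_iff.1 (by rw [hz]; exact neg_le_of_add_eq_one hy hz hyz))
  rw [neg_add_regular (neg_neg_neg x) (neg_neg_neg y), hx, hy,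
    neg_add_regular (neg_neg_neg y) (neg_neg_neg z), hy, hz] at h
  rw [neg_add_regular (regular_mul hx hy) hz, h, ← neg_add_regular hx (regular_mul hy hz)]

/-- Each of the pairs `x, y` and `y, z` either sums to `1` or multiplies to `0`; the four
combinations are settled by the exchange identities between `add` and `*`. -/
theorem seqAdd_assoc_of_regular {x y z : C} (hx : neg (neg x) = x) (hy : neg (neg y) = y)
    (hz : neg (neg z) = z) (n m k : ℕ) :
    seqAdd (seqAdd (std n x) (std m y)) (std k z) =
      seqAdd (std n x) (seqAdd (std m y) (std k z)) := by
  rcases add_eq_one_or_mul_eq_zero x y with hxy | hxy <;>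
  rcases add_eq_one_or_mul_eq_zero y z with hyz | hyz
  · rw [seqAdd_std_of_add_eq hxy, seqAdd_std_of_add_eq hyz, seqAdd_std, seqAdd_std,
      mul_add_eq_add_mul hx hy hz hxy hyz, mul_assoc, show n + m + 1 + k = n + (m + k + 1) by omega]
  · rw [seqAdd_std_of_add_eq hxy, seqAdd_std_of_mul_eq hyz,
      seqAdd_std_of_mul_eq (by rw [mul_assoc, hyz, mul_zero']),
      seqAdd_std_of_add_eq (by rw [← add_assoc', hxy, one_add']),
      mul_add_eq_mul_add hx hy hz hxy hyz, show n + m + 1 + k = n + (m + k) + 1 by omega]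
  · have h := mul_add_eq_mul_add hz hy hx (by rwa [add_comm']) (by rwa [mul_comm])
    rw [seqAdd_std_of_mul_eq hxy, seqAdd_std_of_add_eq hyz,
      seqAdd_std_of_add_eq (by rw [add_assoc', hyz, add_one']),
      seqAdd_std_of_mul_eq (by rw [← mul_assoc, hxy, zero_mul']),
      add_comm' x (y * z), mul_comm y z, h, mul_comm z, add_comm' y x,
      show n + m + k + 1 = n + (m + k + 1) by omega]
  · rw [seqAdd_std_of_mul_eq hxy, seqAdd_std_of_mul_eq hyz, seqAdd_std, seqAdd_std,
      add_assoc', add_mul_eq_mul_add hx hy hz hxy hyz, Nat.add_assoc]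

/-- Leading ones of a summand only shift the sum, so a common block of them can be dropped from a
comparison. -/
theorem seqAdd_std_apply_add (n m : ℕ) (x y : C) (i : ℕ) :
    seqAdd (std n x) (std m y) (i + m) = seqAdd (std n x) (std 0 y) i := by
  rw [seqAdd_std, seqAdd_std]
  simp only [std₂, Nat.add_zero, Nat.add_lt_add_iff_right, Nat.add_right_cancel_iff,
    Nat.add_right_comm n m 1]

theorem le_of_seqAdd_std_le {a b : ℕ → C} (ha : IsGood a) (hb : IsGood b) {n : ℕ} {x : C}
    (h : seqAdd a (std n x) ≤ seqAdd b (std n x)) :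
    seqAdd a (std 0 x) ≤ seqAdd b (std 0 x) := by
  obtain ⟨p, u, rfl⟩ := exists_std ha
  obtain ⟨q, v, rfl⟩ := exists_std hb
  intro i
  simpa only [seqAdd_std_apply_add] using h (i + n)

/-- Adding `(neg z)` completes `std k z` to a sequence consisting of leading ones alone, which
cancel. -/
theorem le_of_seqAdd_le_of_regular {x y z : C} (hx : neg (neg x) = x) (hy : neg (neg y) = y)
    (hz : neg (neg z) = z) {n m k : ℕ}
    (h : seqAdd (std n x) (std k z) ≤ seqAdd (std m y) (std k z)) : std n x ≤ std m y := by
  have h1 := seqAdd_mono h (le_refl (std 0 (neg z)))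
  have hadd : add z (neg z) = 1 := by
    rw [add_regular hz (neg_neg_neg z), imp_self]
  rw [seqAdd_assoc_of_regular hx hz (neg_neg_neg z), seqAdd_assoc_of_regular hy hz (neg_neg_neg z),
    seqAdd_std_of_add_eq hadd, mul_neg_self] at h1
  have h2 := le_of_seqAdd_std_le (isGood_std _ _) (isGood_std _ _) h1
  rwa [std_zero_zero, seqAdd_zero (isGood_std _ _), seqAdd_zero (isGood_std _ _)] at h2

/-- The double negation. -/
def doubleNeg (x : C) : C := neg (neg x)

theorem doubleNeg_comp_std (n : ℕ) (x : C) : doubleNeg ∘ std n x = std n (doubleNeg x) := by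
  funext i
  simp only [Function.comp_apply, std]
  split_ifs
  · rw [doubleNeg, neg_one', neg_zero']
  · rfl
  · rw [doubleNeg, neg_zero', neg_one']

theorem doubleNeg_comp_mono {a b : ℕ → C} (h : a ≤ b) : doubleNeg ∘ a ≤ doubleNeg ∘ b :=
  fun i => neg_anti (neg_anti (h i))

theorem doubleNeg_comp_seqAdd (a b : ℕ → C) :
    doubleNeg ∘ seqAdd a b = seqAdd (doubleNeg ∘ a) (doubleNeg ∘ b) :=
  (seqAdd_comp neg_neg_add neg_neg_mul a b).symm

theorem doubleNeg_comp_assoc {a b c : ℕ → C} (ha : IsGood a) (hb : IsGood b) (hc : IsGood c) :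
    doubleNeg ∘ seqAdd (seqAdd a b) c = doubleNeg ∘ seqAdd a (seqAdd b c) := by
  obtain ⟨n, x, rfl⟩ := exists_std ha
  obtain ⟨m, y, rfl⟩ := exists_std hb
  obtain ⟨k, z, rfl⟩ := exists_std hc
  simp only [doubleNeg_comp_seqAdd, doubleNeg_comp_std]
  exact seqAdd_assoc_of_regular (neg_neg_neg _) (neg_neg_neg _) (neg_neg_neg _) _ _ _

theorem doubleNeg_comp_le_of_seqAdd_le {a b c : ℕ → C} (ha : IsGood a) (hb : IsGood b)
    (hc : IsGood c) (h : seqAdd a c ≤ seqAdd b c) : doubleNeg ∘ a ≤ doubleNeg ∘ b := by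
  replace h := doubleNeg_comp_mono h
  obtain ⟨n, x, rfl⟩ := exists_std ha
  obtain ⟨m, y, rfl⟩ := exists_std hb
  obtain ⟨k, z, rfl⟩ := exists_std hc
  simp only [doubleNeg_comp_seqAdd, doubleNeg_comp_std] at h ⊢
  exact le_of_seqAdd_le_of_regular (neg_neg_neg _) (neg_neg_neg _) (neg_neg_neg _) h

/-- Next to such a `z` a dense `x` acts like `1`: `add x z = 1` and `x * z = z`. -/
theorem seqAdd_single_eq {z : C} (hz : z ≠ 0) (hz' : neg z ≠ 0) {a : ℕ → C} (ha : IsGood a) :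
    seqAdd a (std 0 z) = seqAdd (doubleNeg ∘ a) (std 0 z) := by
  obtain ⟨n, x, rfl⟩ := exists_std ha
  rw [doubleNeg_comp_std, seqAdd_std, seqAdd_std]
  rcases neg_eq_zero_or x with hx | hx
  · rw [dense_add hx hz, dense_mul_eq hx hz', doubleNeg, hx, neg_zero', one_add', one_mul]
  · rw [doubleNeg, hx]

theorem seqAdd_single_le_of_doubleNeg {z : C} (hz : z ≠ 0) (hz' : neg z ≠ 0) {a b : ℕ → C}
    (ha : IsGood a) (hb : IsGood b) (h : doubleNeg ∘ a ≤ doubleNeg ∘ b) :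
    seqAdd a (std 0 z) ≤ seqAdd b (std 0 z) := by
  rw [seqAdd_single_eq hz hz' ha, seqAdd_single_eq hz hz' hb]
  exact seqAdd_mono h le_rfl

/-! ### Dense elements -/

theorem dense_add_dense {x y : C} (hx : neg x = 0) (hy : neg y = 0) : add x y = 1 := by
  by_cases h : y = 0
  · rw [h, neg_zero'] at hy
    exact eq_of_zero_eq_one hy.symm _ _
  · exact dense_add hx h

/-- If the entry after the leading ones is `0`, the last of those ones takes its place. -/
theorem eq_zero_or_exists_std {P : C → Prop} (h1 : P 1) {a : ℕ → C} (ha : IsGood a)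
    (h : ∀ i, a i = 0 ∨ P (a i)) : a = 0 ∨ ∃ n x, P x ∧ a = std n x := by
  obtain ⟨n, x, rfl⟩ := exists_std ha
  have hx := h n
  rw [std, if_neg (lt_irrefl n), if_pos rfl] at hx
  rcases hx with rfl | hx
  · cases n with
    | zero => exact Or.inl std_zero_zero
    | succ n => exact Or.inr ⟨n, 1, h1, std_succ_zero n⟩
  · exact Or.inr ⟨n, x, hx, rfl⟩

/-- Dense elements add up to `1`, so for nonzero sequences the sum merely counts leading ones and
multiplies the final entries. -/
theorem seqAdd_assoc_of_dense {a b c : ℕ → C} (ha : IsGood a) (hb : IsGood b) (hc : IsGood c)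
    (ha' : ∀ i, a i = 0 ∨ neg (a i) = 0) (hb' : ∀ i, b i = 0 ∨ neg (b i) = 0)
    (hc' : ∀ i, c i = 0 ∨ neg (c i) = 0) :
    seqAdd (seqAdd a b) c = seqAdd a (seqAdd b c) := by
  rcases eq_zero_or_exists_std (P := fun x => neg x = 0) neg_one' ha ha' with rfl | ⟨n, x, hx, rfl⟩
  · rw [zero_seqAdd hb, zero_seqAdd (isGood_seqAdd hb hc)]
  rcases eq_zero_or_exists_std (P := fun x => neg x = 0) neg_one' hb hb' with rfl | ⟨m, y, hy, rfl⟩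
  · rw [zero_seqAdd hc, seqAdd_zero ha]
  rcases eq_zero_or_exists_std (P := fun x => neg x = 0) neg_one' hc hc' with rfl | ⟨k, z, hz, rfl⟩
  · rw [seqAdd_zero hb, seqAdd_zero (isGood_seqAdd ha hb)]
  rw [seqAdd_std_of_add_eq (dense_add_dense hx hy), seqAdd_std_of_add_eq (dense_add_dense hy hz),
    seqAdd_std_of_add_eq (dense_add_dense (dense_mul hx hy) hz),
    seqAdd_std_of_add_eq (dense_add_dense hx (dense_mul hy hz)), mul_assoc,
    show n + m + 1 + k + 1 = n + (m + k + 1) + 1 by omega]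

/-! ### Absorbing elements -/

/-- Either `z` lies strictly between `0` and the dense elements, or `z` is dense and is a multiple
of all nonzero terms of `q`, which are dense as well. -/
def Absorbs (z : C) (q : ℕ → C) : Prop :=
  (z ≠ 0 ∧ neg z ≠ 0) ∨ (neg z = 0 ∧ ∀ i, q i = 0 ∨ neg (q i) = 0 ∧ q i ∣ z)

theorem Absorbs.dense {z : C} (hz : ¬ (z ≠ 0 ∧ neg z ≠ 0)) {q : ℕ → C} (h : Absorbs z q) (i : ℕ) :
    q i = 0 ∨ neg (q i) = 0 :=
  ((h.resolve_left hz).2 i).imp_right And.left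

theorem single_dense {z : C} (hz : neg z = 0) (i : ℕ) :
    std 0 z i = 0 ∨ neg (std 0 z i) = 0 := by
  simp only [std]
  split_ifs
  exacts [Or.inr neg_one', Or.inr hz, Or.inl rfl]

theorem seqAdd_assoc_single {z : C} {a b c : ℕ → C} (ha : IsGood a) (hb : IsGood b)
    (hc : IsGood c) (ha' : Absorbs z a) (hb' : Absorbs z b) (hc' : Absorbs z c) :
    seqAdd (seqAdd (seqAdd a b) c) (std 0 z) = seqAdd (seqAdd a (seqAdd b c)) (std 0 z) := by
  by_cases hz : z ≠ 0 ∧ neg z ≠ 0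
  · rw [seqAdd_single_eq hz.1 hz.2 (isGood_seqAdd (isGood_seqAdd ha hb) hc),
      doubleNeg_comp_assoc ha hb hc,
      ← seqAdd_single_eq hz.1 hz.2 (isGood_seqAdd ha (isGood_seqAdd hb hc))]
  · rw [seqAdd_assoc_of_dense ha hb hc (ha'.dense hz) (hb'.dense hz) (hc'.dense hz)]

theorem seqAdd_single_le {z : C} {a b c : ℕ → C} (ha : IsGood a) (hb : IsGood b) (hc : IsGood c)
    (ha' : Absorbs z a) (hb' : Absorbs z b) (hc' : Absorbs z c)
    (h : seqAdd a c ≤ seqAdd b c) : seqAdd a (std 0 z) ≤ seqAdd b (std 0 z) := by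
  by_cases hz : z ≠ 0 ∧ neg z ≠ 0
  · exact seqAdd_single_le_of_doubleNeg hz.1 hz.2 ha hb
      (doubleNeg_comp_le_of_seqAdd_le ha hb hc h)
  have hzd := (hc'.resolve_left hz).1
  rcases eq_zero_or_exists_std (P := fun x => neg x = 0 ∧ x ∣ z) ⟨neg_one', one_dvd z⟩ hc
    (hc'.resolve_left hz).2 with rfl | ⟨n, x, ⟨hx, w, rfl⟩, rfl⟩
  · rw [seqAdd_zero ha, seqAdd_zero hb] at h
    exact seqAdd_mono h le_rfl
  -- The cofactor `w` in `z = x * w` is dense as well, and adding `(w)` to `std n x` gives `std (n +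
  -- 1) z`; its leading ones can then be dropped.
  have hw : neg w = 0 := le_zero_iff.1 (hzd ▸ neg_anti (mul_le_right x w))
  have h1 := seqAdd_mono h (le_refl (std 0 w))
  rw [seqAdd_assoc_of_dense ha hc (isGood_std _ _) (ha'.dense hz) (hc'.dense hz) (single_dense hw),
    seqAdd_assoc_of_dense hb hc (isGood_std _ _) (hb'.dense hz) (hc'.dense hz) (single_dense hw),
    seqAdd_std_of_add_eq (dense_add_dense hx hw)] at h1
  exact le_of_seqAdd_std_le ha hb h1

theorem seqAdd_right_single_le {z : C} {a b c d : ℕ → C} (ha : IsGood a) (hb : IsGood b)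
    (hc : IsGood c) (hd : IsGood d) (ha' : Absorbs z a) (hb' : Absorbs z b) (hc' : Absorbs z c)
    (hd' : Absorbs z d) (h : seqAdd a c ≤ seqAdd b c) :
    seqAdd (seqAdd a d) (std 0 z) ≤ seqAdd (seqAdd b d) (std 0 z) := by
  by_cases hz : z ≠ 0 ∧ neg z ≠ 0
  · refine seqAdd_single_le_of_doubleNeg hz.1 hz.2 (isGood_seqAdd ha hd) (isGood_seqAdd hb hd) ?_
    rw [doubleNeg_comp_seqAdd, doubleNeg_comp_seqAdd]
    exact seqAdd_mono (doubleNeg_comp_le_of_seqAdd_le ha hb hc h) le_rfl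
  have hzd := single_dense (hc'.resolve_left hz).1
  have hs := isGood_std 0 z
  have h1 := seqAdd_mono (seqAdd_single_le ha hb hc ha' hb' hc' h) (le_refl d)
  rwa [seqAdd_assoc_of_dense ha hs hd (ha'.dense hz) hzd (hd'.dense hz),
    seqAdd_assoc_of_dense hb hs hd (hb'.dense hz) hzd (hd'.dense hz), seqAdd_comm hs hd,
    ← seqAdd_assoc_of_dense ha hd hs (ha'.dense hz) (hd'.dense hz) hzd,
    ← seqAdd_assoc_of_dense hb hd hs (hb'.dense hz) (hd'.dense hz) hzd] at h1

theorem single_le_of_seqAdd_le {z : C} {a b c d : ℕ → C} (ha : IsGood a) (hb : IsGood b)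
    (hc : IsGood c) (hd : IsGood d) (ha' : Absorbs z a) (hb' : Absorbs z b) (hc' : Absorbs z c)
    (hd' : Absorbs z d) (hdc : Absorbs z (seqAdd d c))
    (h : seqAdd (seqAdd a d) c ≤ seqAdd (seqAdd b d) c) :
    seqAdd a (std 0 z) ≤ seqAdd b (std 0 z) := by
  by_cases hz : z ≠ 0 ∧ neg z ≠ 0
  · have h1 := doubleNeg_comp_mono h
    rw [doubleNeg_comp_assoc ha hd hc, doubleNeg_comp_assoc hb hd hc] at h1
    refine seqAdd_single_le_of_doubleNeg hz.1 hz.2 ha hb ?_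
    have hd1 := isGood_seqAdd hd hc
    obtain ⟨n, x, rfl⟩ := exists_std ha
    obtain ⟨m, y, rfl⟩ := exists_std hb
    obtain ⟨k, w, hw⟩ := exists_std hd1
    rw [hw, doubleNeg_comp_seqAdd, doubleNeg_comp_seqAdd] at h1
    simp only [doubleNeg_comp_std] at h1 ⊢
    exact le_of_seqAdd_le_of_regular (neg_neg_neg _) (neg_neg_neg _) (neg_neg_neg _) h1
  · rw [seqAdd_assoc_of_dense ha hd hc (ha'.dense hz) (hd'.dense hz) (hc'.dense hz),
      seqAdd_assoc_of_dense hb hd hc (hb'.dense hz) (hd'.dense hz) (hc'.dense hz)] at h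
    exact seqAdd_single_le ha hb (isGood_seqAdd hd hc) ha' hb' hdc h

end Chain

-- Transfer from chains and construction of absorbing elements

universe u

section

variable {L : Type u} [BLAlgebra L]

theorem seq_le_of_forall_chain {a b : ℕ → L}
    (h : ∀ (C : Type u) [Chain C] (f : Hom L C), f.toFun ∘ a ≤ f.toFun ∘ b) : a ≤ b :=
  fun i => le_of_forall_chain fun C _ f => h C f i

theorem seq_eq_of_forall_chain {a b : ℕ → L}
    (h : ∀ (C : Type u) [Chain C] (f : Hom L C), f.toFun ∘ a = f.toFun ∘ b) : a = b :=
  funext fun i => eq_of_forall_chain fun C _ f => congrFun (h C f) i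

theorem isGood_of_forall_chain {a : ℕ → L} (hN : ∃ n, ∀ r, n ≤ r → a r = 0)
    (h : ∀ (C : Type u) [Chain C] (f : Hom L C), IsGood (f.toFun ∘ a)) : IsGood a :=
  ⟨fun i => eq_of_forall_chain fun C _ f => by rw [f.map_add]; exact (h C f).1 i, hN⟩

theorem IsGood.seqAdd {a b : ℕ → L} (ha : IsGood a) (hb : IsGood b) : IsGood (seqAdd a b) := by
  refine isGood_of_forall_chain ?_ fun C _ f => ?_
  · obtain ⟨-, n, hn⟩ := ha
    obtain ⟨-, m, hm⟩ := hb
    exact ⟨n + m, seqAdd_eq_zero_of_le hn hm⟩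
  · rw [f.map_seqAdd]
    exact Chain.isGood_seqAdd (f.isGood_comp ha) (f.isGood_comp hb)

theorem Hom.comp_sup {M : Type*} [BLAlgebra M] (f : Hom L M) (a b : ℕ → L) :
    f.toFun ∘ (a ⊔ b) = f.toFun ∘ a ⊔ f.toFun ∘ b :=
  funext fun _ => f.map_sup _ _

theorem Hom.comp_inf {M : Type*} [BLAlgebra M] (f : Hom L M) (a b : ℕ → L) :
    f.toFun ∘ (a ⊓ b) = f.toFun ∘ a ⊓ f.toFun ∘ b :=
  funext fun _ => f.map_inf _ _

theorem IsGood.sup {a b : ℕ → L} (ha : IsGood a) (hb : IsGood b) : IsGood (a ⊔ b) := by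
  refine isGood_of_forall_chain ?_ fun C _ f => ?_
  · obtain ⟨-, n, hn⟩ := ha
    obtain ⟨-, m, hm⟩ := hb
    refine ⟨max n m, fun r hr => ?_⟩
    rw [Pi.sup_apply, hn r (le_of_max_le_left hr), hm r (le_of_max_le_right hr), sup_idem]
  · rw [f.comp_sup]
    rcases Chain.IsGood.le_total (f.isGood_comp ha) (f.isGood_comp hb) with h | h
    · rw [sup_eq_right.2 h]; exact f.isGood_comp hb
    · rw [sup_eq_left.2 h]; exact f.isGood_comp ha

theorem IsGood.inf {a b : ℕ → L} (ha : IsGood a) (hb : IsGood b) : IsGood (a ⊓ b) := by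
  refine isGood_of_forall_chain ?_ fun C _ f => ?_
  · obtain ⟨-, n, hn⟩ := ha
    obtain ⟨-, m, hm⟩ := hb
    refine ⟨max n m, fun r hr => ?_⟩
    rw [Pi.inf_apply, hn r (le_of_max_le_left hr), hm r (le_of_max_le_right hr), inf_idem]
  · rw [f.comp_inf]
    rcases Chain.IsGood.le_total (f.isGood_comp ha) (f.isGood_comp hb) with h | h
    · rw [inf_eq_left.2 h]; exact f.isGood_comp ha
    · rw [inf_eq_right.2 h]; exact f.isGood_comp hb

/-- Good sequences of a chain are comparable, so monotonicity of the sum suffices there. -/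
theorem sup_seqAdd {a b c : ℕ → L} (ha : IsGood a) (hb : IsGood b) :
    seqAdd (a ⊔ b) c = seqAdd a c ⊔ seqAdd b c := by
  refine seq_eq_of_forall_chain fun C _ f => ?_
  simp only [f.map_seqAdd, f.comp_sup]
  rcases Chain.IsGood.le_total (f.isGood_comp ha) (f.isGood_comp hb) with h | h
  · rw [sup_eq_right.2 h, sup_eq_right.2 (seqAdd_mono h le_rfl)]
  · rw [sup_eq_left.2 h, sup_eq_left.2 (seqAdd_mono h le_rfl)]

theorem inf_seqAdd {a b c : ℕ → L} (ha : IsGood a) (hb : IsGood b) :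
    seqAdd (a ⊓ b) c = seqAdd a c ⊓ seqAdd b c := by
  refine seq_eq_of_forall_chain fun C _ f => ?_
  simp only [f.map_seqAdd, f.comp_inf]
  rcases Chain.IsGood.le_total (f.isGood_comp ha) (f.isGood_comp hb) with h | h
  · rw [inf_eq_left.2 h, inf_eq_left.2 (seqAdd_mono h le_rfl)]
  · rw [inf_eq_right.2 h, inf_eq_right.2 (seqAdd_mono h le_rfl)]

theorem Hom.comp_std {M : Type*} [BLAlgebra M] (f : Hom L M) (n : ℕ) (z : L) :
    f.toFun ∘ std n z = std n (f.toFun z) := by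
  funext i
  simp only [Function.comp_apply, std]
  split_ifs
  exacts [f.map_one, rfl, f.map_zero]

/-- Take `u` as the join of all `y ⊓ neg y` and `p` as the product of all `y ⊔ neg y`. In a chain
`u` is `0` or one of the elements `y ⊓ neg y`, so its square is `0`. If `u = 0`, every `y` is `0` or
dense, the factors of `p` are `1` or `y` itself, and `p` is a dense multiple of the nonzero `y`. -/
theorem exists_regular_dense (l : List L) : ∃ u p : L, ∀ (C : Type u) [Chain C] (f : Hom L C),
    f.toFun u * f.toFun u = 0 ∧ (f.toFun u ≠ 0 ∨ f.toFun u = 0 ∧ neg (f.toFun p) = 0 ∧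
      ∀ y ∈ l, f.toFun y = 0 ∨ neg (f.toFun y) = 0 ∧ f.toFun y ∣ f.toFun p) := by
  induction l with
  | nil =>
    refine ⟨0, 1, fun _ _ f => ?_⟩
    rw [f.map_zero, f.map_one]
    exact ⟨mul_zero' 0, Or.inr ⟨rfl, neg_one', fun y hy => absurd hy List.not_mem_nil⟩⟩
  | cons y l ih =>
    obtain ⟨u, p, h⟩ := ih
    refine ⟨u ⊔ (y ⊓ neg y), p * (y ⊔ neg y), fun C _ f => ?_⟩
    obtain ⟨h1, h2⟩ := h C f
    simp only [f.map_sup, f.map_inf, f.map_mul, f.map_neg]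
    set v := f.toFun u
    set w := f.toFun y
    refine ⟨?_, ?_⟩
    · rcases Chain.sup_eq_or v (w ⊓ neg w) with h | h
      · rw [h, h1]
      · rw [h, ← le_zero_iff, ← mul_neg_self w]
        exact mul_le_mul_of_le inf_le_left inf_le_right
    · by_cases hv : v ⊔ (w ⊓ neg w) = 0
      · right
        have hv0 : v = 0 := le_zero_iff.1 (hv ▸ le_sup_left)
        have hw0 : w ⊓ neg w = 0 := le_zero_iff.1 (hv ▸ le_sup_right)
        obtain ⟨-, h3, h4⟩ := h2.resolve_left (not_not.2 hv0)
        have hdense : neg (w ⊔ neg w) = 0 ∧ (w = 0 ∨ neg w = 0 ∧ w ∣ w ⊔ neg w) := by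
          rcases Chain.inf_eq_or w (neg w) with h | h
          · have : w = 0 := h.symm.trans hw0
            rw [this, neg_zero', sup_eq_right.2 (le_one _), neg_one']
            exact ⟨rfl, Or.inl rfl⟩
          · have : neg w = 0 := h.symm.trans hw0
            rw [this, sup_eq_left.2 (bot_le' _)]
            exact ⟨this, Or.inr ⟨rfl, dvd_rfl⟩⟩
        refine ⟨hv, Chain.dense_mul h3 hdense.1, fun x hx => ?_⟩
        rcases List.mem_cons.1 hx with rfl | hx
        · exact hdense.2.imp_right fun h => ⟨h.1, h.2.mul_left _⟩
        · exact (h4 x hx).imp_right fun h => ⟨h.1, h.2.mul_right _⟩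
      · exact Or.inl hv

/-- The element `(p ⊓ neg u) ⊔ u` equals `p` where `u = 0`; elsewhere it lies between `u` and `neg
u`, hence is neither `0` nor dense. -/
theorem exists_strict_or_dense (l : List L) : ∃ z : L, ∀ (C : Type u) [Chain C] (f : Hom L C),
    (f.toFun z ≠ 0 ∧ neg (f.toFun z) ≠ 0) ∨ (neg (f.toFun z) = 0 ∧
      ∀ y ∈ l, f.toFun y = 0 ∨ neg (f.toFun y) = 0 ∧ f.toFun y ∣ f.toFun z) := by
  obtain ⟨u, p, h⟩ := exists_regular_dense l
  refine ⟨(p ⊓ neg u) ⊔ u, fun C _ f => ?_⟩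
  obtain ⟨h1, h2⟩ := h C f
  simp only [f.map_sup, f.map_inf, f.map_neg]
  rcases h2 with h2 | ⟨h2, h3⟩
  · left
    have hz : (f.toFun p ⊓ neg (f.toFun u)) ⊔ f.toFun u ≤ neg (f.toFun u) :=
      sup_le inf_le_right (le_neg_iff.2 h1)
    refine ⟨fun h => h2 (le_zero_iff.1 (h ▸ le_sup_right)), fun h => h2 (le_zero_iff.1 ?_)⟩
    exact (le_neg_neg _).trans (h ▸ neg_anti hz)
  · right
    rwa [h2, neg_zero', inf_eq_left.2 (le_one _), sup_eq_left.2 (bot_le' _)]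

end

/-! ### Stable comparison of good sequences -/

namespace GoodSeq

variable {L : Type u} [BLAlgebra L]

instance : Add (GoodSeq L) := ⟨fun a b => ⟨seqAdd a.1 b.1, a.2.seqAdd b.2⟩⟩

instance : Max (GoodSeq L) := ⟨fun a b => ⟨a.1 ⊔ b.1, a.2.sup b.2⟩⟩

instance : Min (GoodSeq L) := ⟨fun a b => ⟨a.1 ⊓ b.1, a.2.inf b.2⟩⟩

theorem add_comm' (a b : GoodSeq L) : a + b = b + a :=
  Subtype.ext <| seq_eq_of_forall_chain fun _ _ f =>
    (f.map_seqAdd _ _).trans <| (Chain.seqAdd_comm (f.isGood_comp a.2) (f.isGood_comp b.2)).trans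
      (f.map_seqAdd _ _).symm

theorem add_zero' (a : GoodSeq L) : a + 0 = a := by
  refine Subtype.ext <| seq_eq_of_forall_chain fun C _ f => (f.map_seqAdd _ _).trans ?_
  have h0 : f.toFun ∘ (0 : GoodSeq L).1 = 0 := funext fun _ => f.map_zero
  rw [h0, Chain.seqAdd_zero (f.isGood_comp a.2)]

/-- The good sequence `(z, 0, 0, …)`. -/
def single (z : L) : GoodSeq L := ⟨std 0 z, isGood_std 0 z⟩

/-- In every totally ordered quotient, `z` absorbs `q`. -/
def Absorbed (z : L) (q : GoodSeq L) : Prop :=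
  ∀ (C : Type u) [Chain C] (f : Hom L C), Chain.Absorbs (f.toFun z) (f.toFun ∘ q.1)

theorem exists_absorbed (l : List (GoodSeq L)) : ∃ z : L, ∀ q ∈ l, Absorbed z q := by
  have hl : ∃ l' : List L, ∀ q ∈ l, ∀ i, q.1 i = 0 ∨ q.1 i ∈ l' := by
    induction l with
    | nil => exact ⟨[], fun q hq => absurd hq List.not_mem_nil⟩
    | cons a l ih =>
      obtain ⟨l', h⟩ := ih
      obtain ⟨n, hn⟩ := a.2.2
      refine ⟨(List.range n).map a.1 ++ l', fun q hq i => ?_⟩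
      rcases List.mem_cons.1 hq with rfl | hq
      · rcases le_or_gt n i with hi | hi
        · exact Or.inl (hn i hi)
        · exact Or.inr (List.mem_append_left _ (List.mem_map_of_mem (List.mem_range.2 hi)))
      · exact (h q hq i).imp_right (List.mem_append_right _)
  obtain ⟨l', hl'⟩ := hl
  obtain ⟨z, hz⟩ := exists_strict_or_dense l'
  refine ⟨z, fun q hq C _ f => (hz C f).imp_right fun h => ⟨h.1, fun i => ?_⟩⟩
  rcases hl' q hq i with h0 | h1
  · left
    rw [Function.comp_apply, h0, f.map_zero]
  · exact h.2 _ h1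

theorem add_single_le {z : L} {a b k : GoodSeq L} (ha : Absorbed z a) (hb : Absorbed z b)
    (hk : Absorbed z k) (h : (a + k).1 ≤ (b + k).1) : (a + single z).1 ≤ (b + single z).1 := by
  refine seq_le_of_forall_chain fun C _ f => ?_
  have h' : f.toFun ∘ (a + k).1 ≤ f.toFun ∘ (b + k).1 := fun i => f.mono (h i)
  change f.toFun ∘ seqAdd _ _ ≤ f.toFun ∘ seqAdd _ _ at h' ⊢
  simp only [f.map_seqAdd, single, f.comp_std] at h' ⊢
  exact Chain.seqAdd_single_le (f.isGood_comp a.2) (f.isGood_comp b.2) (f.isGood_comp k.2)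
    (ha C f) (hb C f) (hk C f) h'

theorem add_add_single_le {z : L} {a b k c : GoodSeq L} (ha : Absorbed z a) (hb : Absorbed z b)
    (hk : Absorbed z k) (hc : Absorbed z c) (h : (a + k).1 ≤ (b + k).1) :
    (a + c + single z).1 ≤ (b + c + single z).1 := by
  refine seq_le_of_forall_chain fun C _ f => ?_
  have h' : f.toFun ∘ (a + k).1 ≤ f.toFun ∘ (b + k).1 := fun i => f.mono (h i)
  change f.toFun ∘ seqAdd _ _ ≤ f.toFun ∘ seqAdd _ _ at h'
  change f.toFun ∘ seqAdd (seqAdd _ _) _ ≤ f.toFun ∘ seqAdd (seqAdd _ _) _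
  simp only [f.map_seqAdd, single, f.comp_std] at h' ⊢
  exact Chain.seqAdd_right_single_le (f.isGood_comp a.2) (f.isGood_comp b.2) (f.isGood_comp k.2)
    (f.isGood_comp c.2) (ha C f) (hb C f) (hk C f) (hc C f) h'

theorem add_single_le_of_add_add_le {z : L} {a b k c : GoodSeq L} (ha : Absorbed z a)
    (hb : Absorbed z b) (hk : Absorbed z k) (hc : Absorbed z c) (hck : Absorbed z (c + k))
    (h : (a + c + k).1 ≤ (b + c + k).1) : (a + single z).1 ≤ (b + single z).1 := by
  refine seq_le_of_forall_chain fun C _ f => ?_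
  have h' : f.toFun ∘ (a + c + k).1 ≤ f.toFun ∘ (b + c + k).1 := fun i => f.mono (h i)
  have hck' := hck C f
  change Chain.Absorbs _ (f.toFun ∘ seqAdd _ _) at hck'
  change f.toFun ∘ seqAdd (seqAdd _ _) _ ≤ f.toFun ∘ seqAdd (seqAdd _ _) _ at h'
  change f.toFun ∘ seqAdd _ _ ≤ f.toFun ∘ seqAdd _ _
  simp only [f.map_seqAdd, single, f.comp_std] at h' hck' ⊢
  exact Chain.single_le_of_seqAdd_le (f.isGood_comp a.2) (f.isGood_comp b.2) (f.isGood_comp k.2)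
    (f.isGood_comp c.2) (ha C f) (hb C f) (hk C f) (hc C f) hck' h'

theorem add_assoc_single {z : L} {a b c : GoodSeq L} (ha : Absorbed z a)
    (hb : Absorbed z b) (hc : Absorbed z c) :
    a + b + c + single z = a + (b + c) + single z := by
  refine Subtype.ext <| seq_eq_of_forall_chain fun C _ f => ?_
  change f.toFun ∘ seqAdd (seqAdd (seqAdd _ _) _) _ = f.toFun ∘ seqAdd (seqAdd _ (seqAdd _ _)) _
  simp only [f.map_seqAdd, single, f.comp_std]
  exact Chain.seqAdd_assoc_single (f.isGood_comp a.2) (f.isGood_comp b.2) (f.isGood_comp c.2)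
    (ha C f) (hb C f) (hc C f)

/-- `a + k ≤ b + k` for some good sequence `k`. -/
def StableLE (a b : GoodSeq L) : Prop := ∃ k : GoodSeq L, (a + k).1 ≤ (b + k).1

theorem StableLE.of_le {a b : GoodSeq L} (h : a.1 ≤ b.1) : StableLE a b :=
  ⟨0, seqAdd_mono h le_rfl⟩

theorem StableLE.refl (a : GoodSeq L) : StableLE a a := .of_le le_rfl

/-- A common witness for two comparisons is what makes transitivity, antisymmetry and the bounds for
joins and meets work without associativity. -/
theorem StableLE.exists_single_pair {a b c d : GoodSeq L} (h : StableLE a b) (h' : StableLE c d) :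
    ∃ z : L, (a + single z).1 ≤ (b + single z).1 ∧ (c + single z).1 ≤ (d + single z).1 := by
  obtain ⟨k, hk⟩ := h
  obtain ⟨k', hk'⟩ := h'
  obtain ⟨z, hz⟩ := exists_absorbed [a, b, c, d, k, k']
  exact ⟨z, add_single_le (hz _ (by simp)) (hz _ (by simp)) (hz _ (by simp)) hk,
    add_single_le (hz _ (by simp)) (hz _ (by simp)) (hz _ (by simp)) hk'⟩

theorem StableLE.trans {a b c : GoodSeq L} (h : StableLE a b) (h' : StableLE b c) :
    StableLE a c := by
  obtain ⟨z, h1, h2⟩ := h.exists_single_pair h'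
  exact ⟨single z, h1.trans h2⟩

theorem stableLE_and_iff {a b : GoodSeq L} :
    StableLE a b ∧ StableLE b a ↔ ∃ k, a + k = b + k := by
  constructor
  · rintro ⟨h, h'⟩
    obtain ⟨z, h1, h2⟩ := h.exists_single_pair h'
    exact ⟨single z, Subtype.ext (le_antisymm h1 h2)⟩
  · rintro ⟨k, hk⟩
    exact ⟨⟨k, by rw [hk]⟩, ⟨k, by rw [hk]⟩⟩

theorem StableLE.add_right {a b : GoodSeq L} (h : StableLE a b) (c : GoodSeq L) :
    StableLE (a + c) (b + c) := by
  obtain ⟨k, hk⟩ := h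
  obtain ⟨z, hz⟩ := exists_absorbed [a, b, c, k]
  exact ⟨single z, add_add_single_le (hz _ (by simp)) (hz _ (by simp)) (hz _ (by simp))
    (hz _ (by simp)) hk⟩

theorem StableLE.of_add_right {a b c : GoodSeq L} (h : StableLE (a + c) (b + c)) :
    StableLE a b := by
  obtain ⟨k, hk⟩ := h
  -- The sum `c + k` is listed too: in the dense case the comparison is rebracketed and `c + k` is
  -- cancelled as a whole.
  obtain ⟨z, hz⟩ := exists_absorbed [a, b, c, k, c + k]
  exact ⟨single z, add_single_le_of_add_add_le (hz _ (by simp)) (hz _ (by simp)) (hz _ (by simp))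
    (hz _ (by simp)) (hz _ (by simp)) hk⟩

theorem StableLE.add {a b c d : GoodSeq L} (h : StableLE a b) (h' : StableLE c d) :
    StableLE (a + c) (b + d) := by
  refine (h.add_right c).trans ?_
  rw [add_comm' b c, add_comm' b d]
  exact h'.add_right b

theorem exists_assoc (a b c : GoodSeq L) : ∃ k, a + b + c + k = a + (b + c) + k := by
  obtain ⟨z, hz⟩ := exists_absorbed [a, b, c]
  exact ⟨single z, add_assoc_single (hz _ (by simp)) (hz _ (by simp)) (hz _ (by simp))⟩

theorem stableLE_sup_iff {a b c : GoodSeq L} :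
    StableLE (a ⊔ b) c ↔ StableLE a c ∧ StableLE b c := by
  constructor
  · exact fun h => ⟨.trans (.of_le (le_sup_left (a := a.1) (b := b.1))) h,
      .trans (.of_le (le_sup_right (a := a.1) (b := b.1))) h⟩
  · rintro ⟨h, h'⟩
    obtain ⟨z, h1, h2⟩ := h.exists_single_pair h'
    exact ⟨single z, (sup_seqAdd a.2 b.2).trans_le (sup_le h1 h2)⟩

theorem stableLE_inf_iff {a b c : GoodSeq L} :
    StableLE c (a ⊓ b) ↔ StableLE c a ∧ StableLE c b := by
  constructor
  · exact fun h => ⟨h.trans (.of_le (inf_le_left (a := a.1) (b := b.1))),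
      h.trans (.of_le (inf_le_right (a := a.1) (b := b.1)))⟩
  · rintro ⟨h, h'⟩
    obtain ⟨z, h1, h2⟩ := h.exists_single_pair h'
    exact ⟨single z, (le_inf h1 h2).trans_eq (inf_seqAdd a.2 b.2).symm⟩

/-! ### The ordered monoid of stable classes and its group of differences -/

variable (L) in
/-- The stable equality `a + k = b + k` of good sequences. -/
def stableSetoid : Setoid (GoodSeq L) where
  r a b := StableLE a b ∧ StableLE b a
  iseqv := ⟨fun a => ⟨.refl a, .refl a⟩, And.symm, fun h h' => ⟨h.1.trans h'.1, h'.2.trans h.2⟩⟩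

variable (L) in
/-- Good sequences modulo stable equality. -/
def Stable : Type u := Quotient (stableSetoid L)

/-- The class of a good sequence modulo stable equality. -/
def Stable.mk (a : GoodSeq L) : Stable L := Quotient.mk (stableSetoid L) a

theorem Stable.mk_surjective (x : Stable L) : ∃ a, Stable.mk a = x := Quotient.exists_rep x

instance : Zero (Stable L) := ⟨Stable.mk 0⟩

instance : Add (Stable L) :=
  ⟨Quotient.map₂ (· + ·) fun _ _ h _ _ h' => ⟨h.1.add h'.1, h.2.add h'.2⟩⟩

instance : AddCommMonoid (Stable L) where
  add_assoc := by
    rintro ⟨a⟩ ⟨b⟩ ⟨c⟩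
    exact Quotient.sound (stableLE_and_iff.2 (exists_assoc a b c))
  add_zero := by rintro ⟨a⟩; exact congrArg (Quotient.mk _) (add_zero' a)
  zero_add := by
    rintro ⟨a⟩; exact congrArg (Quotient.mk _) ((add_comm' 0 a).trans (add_zero' a))
  add_comm := by rintro ⟨a⟩ ⟨b⟩; exact congrArg (Quotient.mk _) (add_comm' a b)
  nsmul := nsmulRec

instance : PartialOrder (Stable L) where
  le := Quotient.lift₂ StableLE fun _ _ _ _ h h' => propext
    ⟨fun H => (h.2.trans H).trans h'.1, fun H => (h.1.trans H).trans h'.2⟩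
  le_refl := by rintro ⟨a⟩; exact StableLE.refl a
  le_trans := by rintro ⟨a⟩ ⟨b⟩ ⟨c⟩ h h'; exact StableLE.trans h h'
  le_antisymm := by rintro ⟨a⟩ ⟨b⟩ h h'; exact Quotient.sound ⟨h, h'⟩

instance : IsOrderedCancelAddMonoid (Stable L) where
  add_le_add_left := by rintro ⟨a⟩ ⟨b⟩ h ⟨c⟩; exact StableLE.add_right h c
  le_of_add_le_add_left := by
    intro x y z h
    rw [add_comm, add_comm x] at h
    obtain ⟨a, rfl⟩ := x.mk_surjective
    obtain ⟨b, rfl⟩ := y.mk_surjective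
    obtain ⟨c, rfl⟩ := z.mk_surjective
    exact StableLE.of_add_right h

variable (L) in
-- Stable classes form an ordered cancellative monoid, so passing to differences loses no order
-- information; `∼` and `⪯` become equality and order of differences `ψ a - ψ b`.
theorem exists_orderedGroup : ∃ (G : Type u) (_ : AddCommGroup G) (_ : PartialOrder G)
    (_ : IsOrderedAddMonoid G) (ψ : GoodSeq L → G), (∀ a b, ψ (a + b) = ψ a + ψ b) ∧
      (∀ a b, ψ a ≤ ψ b ↔ StableLE a b) ∧ ∀ g, ∃ a b, ψ a - ψ b = g := by
  refine ⟨Algebra.GrothendieckAddGroup (Stable L), inferInstance, inferInstance, inferInstance,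
    fun a => AddLocalization.mk (Stable.mk a) 0, fun a b => ?_, fun a b => ?_, fun g => ?_⟩
  · beta_reduce
    rw [AddLocalization.mk_add, add_zero]; rfl
  · beta_reduce
    rw [AddLocalization.mk_le_mk]
    change (0 : Stable L) + _ ≤ 0 + _ ↔ _
    rw [zero_add, zero_add]; rfl
  · induction g using AddLocalization.induction_on with
    | H x =>
      obtain ⟨x, ⟨y, hy⟩⟩ := x
      obtain ⟨a, rfl⟩ := x.mk_surjective
      obtain ⟨b, rfl⟩ := y.mk_surjective
      refine ⟨a, b, ?_⟩
      beta_reduce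
      rw [Algebra.GrothendieckAddGroup.mk_sub_mk]
      congr 1
      · exact add_zero _
      · exact Subtype.ext (zero_add _)

end GoodSeq

end BLAlgebra

/-! ### Transport to the Chang group -/

theorem theorem5p2 (L : Type*) [BLAlgebra L] :
    -- `∼` is an equivalence relation on pairs of good sequences
    Equivalence (BLAlgebra.grothendieckRel L) ∧
    -- sums and coordinatewise joins and meets of good sequences are good sequences
    ∃ (hadd : ∀ a b : BLAlgebra.GoodSeq L, BLAlgebra.IsGood (BLAlgebra.seqAdd a.1 b.1))
      (hsup : ∀ a b : BLAlgebra.GoodSeq L, BLAlgebra.IsGood (a.1 ⊔ b.1))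
      (hinf : ∀ a b : BLAlgebra.GoodSeq L, BLAlgebra.IsGood (a.1 ⊓ b.1))
      -- `G_L` is an abelian group and a lattice, with the operations and the order given below
      (_ : AddCommGroup (BLAlgebra.ChangGroup L)) (_ : Lattice (BLAlgebra.ChangGroup L)),
      -- the group operations
      BLAlgebra.ChangGroup.mk (0 : BLAlgebra.GoodSeq L) 0 = 0 ∧
      (∀ a b c d : BLAlgebra.GoodSeq L,
        BLAlgebra.ChangGroup.mk a b + BLAlgebra.ChangGroup.mk c d =
          BLAlgebra.ChangGroup.mk ⟨_, hadd a c⟩ ⟨_, hadd b d⟩) ∧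
      (∀ a b : BLAlgebra.GoodSeq L,
        -BLAlgebra.ChangGroup.mk a b = BLAlgebra.ChangGroup.mk b a) ∧
      -- the order
      (∀ a b c d : BLAlgebra.GoodSeq L,
        BLAlgebra.ChangGroup.mk a b ≤ BLAlgebra.ChangGroup.mk c d ↔
          ∃ k : BLAlgebra.GoodSeq L,
            BLAlgebra.seqAdd (BLAlgebra.seqAdd a.1 d.1) k.1 ≤
              BLAlgebra.seqAdd (BLAlgebra.seqAdd b.1 c.1) k.1) ∧
      -- the order is translation invariant
      (∀ x y z : BLAlgebra.ChangGroup L, x ≤ y → x + z ≤ y + z) ∧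
      -- joins and meets
      (∀ a b c d : BLAlgebra.GoodSeq L,
        BLAlgebra.ChangGroup.mk a b ⊔ BLAlgebra.ChangGroup.mk c d =
          BLAlgebra.ChangGroup.mk ⟨_, hsup ⟨_, hadd a d⟩ ⟨_, hadd b c⟩⟩ ⟨_, hadd b d⟩) ∧
      (∀ a b c d : BLAlgebra.GoodSeq L,
        BLAlgebra.ChangGroup.mk a b ⊓ BLAlgebra.ChangGroup.mk c d =
          BLAlgebra.ChangGroup.mk ⟨_, hinf ⟨_, hadd a d⟩ ⟨_, hadd b c⟩⟩ ⟨_, hadd b d⟩) := by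
  obtain ⟨G, _, _, _, ψ, hψ, hle, hsurj⟩ := BLAlgebra.GoodSeq.exists_orderedGroup L
  have hψ0 : ψ 0 = 0 := by
    have := hψ 0 0
    rwa [BLAlgebra.GoodSeq.add_zero', left_eq_add] at this
  have hinj : ∀ a b, ψ a = ψ b ↔ ∃ k, a + k = b + k := fun a b => by
    rw [le_antisymm_iff, hle, hle, BLAlgebra.GoodSeq.stableLE_and_iff]
  have hrel : ∀ p q, BLAlgebra.grothendieckRel L p q ↔ ψ p.1 - ψ p.2 = ψ q.1 - ψ q.2 := by
    intro p q
    rw [sub_eq_sub_iff_add_eq_add, add_comm (ψ q.1), ← hψ, ← hψ, hinj]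
    exact exists_congr fun k => ⟨fun h => Subtype.ext h, fun h => congrArg Subtype.val h⟩
  have heqv : Equivalence (BLAlgebra.grothendieckRel L) :=
    ⟨fun p => (hrel p p).2 rfl, fun {p q} h => (hrel q p).2 ((hrel p q).1 h).symm,
      fun {p q r} h h' => (hrel p r).2 (((hrel p q).1 h).trans ((hrel q r).1 h'))⟩
  let e : BLAlgebra.ChangGroup L ≃ G := Equiv.ofBijective
    (Quot.lift (fun p => ψ p.1 - ψ p.2) fun p q h => (hrel p q).1 h) (by
      constructor
      · rintro ⟨p⟩ ⟨q⟩ h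
        exact Quot.sound ((hrel p q).2 h)
      · intro g
        obtain ⟨a, b, h⟩ := hsurj g
        exact ⟨BLAlgebra.ChangGroup.mk a b, h⟩)
  have he : ∀ a b, e (BLAlgebra.ChangGroup.mk a b) = ψ a - ψ b := fun _ _ => rfl
  -- Every bound `g` is a difference `ψ c - ψ d`; moving `d` to the other side and distributing it
  -- over the join leaves a stable comparison of good sequences.
  have hsup : ∀ (a b : BLAlgebra.GoodSeq L) (g : G), ψ (a ⊔ b) ≤ g ↔ ψ a ≤ g ∧ ψ b ≤ g := by
    intro a b g
    obtain ⟨c, d, rfl⟩ := hsurj g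
    have hd : (a ⊔ b) + d = (a + d) ⊔ (b + d) := Subtype.ext (BLAlgebra.sup_seqAdd a.2 b.2)
    simp only [le_sub_iff_add_le, ← hψ, hle, hd, BLAlgebra.GoodSeq.stableLE_sup_iff]
  have hinf : ∀ (a b : BLAlgebra.GoodSeq L) (g : G), g ≤ ψ (a ⊓ b) ↔ g ≤ ψ a ∧ g ≤ ψ b := by
    intro a b g
    obtain ⟨c, d, rfl⟩ := hsurj g
    have hd : (a ⊓ b) + d = (a + d) ⊓ (b + d) := Subtype.ext (BLAlgebra.inf_seqAdd a.2 b.2)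
    simp only [sub_le_iff_le_add, ← hψ, hle, hd, BLAlgebra.GoodSeq.stableLE_inf_iff]
  have hsup' : ∀ (a b c d : BLAlgebra.GoodSeq L) (g : G),
      ψ ((a + d) ⊔ (b + c)) - ψ (b + d) ≤ g ↔ ψ a - ψ b ≤ g ∧ ψ c - ψ d ≤ g := by
    intro a b c d g
    rw [sub_le_iff_le_add, hsup, hψ, hψ, hψ, sub_le_iff_le_add, sub_le_iff_le_add, ← add_assoc,
      add_le_add_iff_right, add_right_comm, add_comm (ψ b), add_le_add_iff_right]
  have hinf' : ∀ (a b c d : BLAlgebra.GoodSeq L) (g : G),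
      g ≤ ψ ((a + d) ⊓ (b + c)) - ψ (b + d) ↔ g ≤ ψ a - ψ b ∧ g ≤ ψ c - ψ d := by
    intro a b c d g
    rw [le_sub_iff_add_le, hinf, hψ, hψ, hψ, le_sub_iff_add_le, le_sub_iff_add_le, ← add_assoc,
      add_le_add_iff_right, add_right_comm, add_comm (ψ b), add_le_add_iff_right]
  have hmk : ∀ x : BLAlgebra.ChangGroup L, ∃ p : BLAlgebra.GoodSeq L × BLAlgebra.GoodSeq L,
      e x = ψ p.1 - ψ p.2 := by
    rintro ⟨p⟩
    exact ⟨p, rfl⟩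
  -- Arbitrary representatives suffice to define join and meet: the universal properties `hsup'` and
  -- `hinf'` depend only on the differences.
  choose r hr using hmk
  let sup (x y : BLAlgebra.ChangGroup L) : BLAlgebra.ChangGroup L := BLAlgebra.ChangGroup.mk
    (((r x).1 + (r y).2) ⊔ ((r x).2 + (r y).1)) ((r x).2 + (r y).2)
  let inf (x y : BLAlgebra.ChangGroup L) : BLAlgebra.ChangGroup L := BLAlgebra.ChangGroup.mk
    (((r x).1 + (r y).2) ⊓ ((r x).2 + (r y).1)) ((r x).2 + (r y).2)
  have hesup : ∀ x y g, e (sup x y) ≤ g ↔ e x ≤ g ∧ e y ≤ g := fun x y g => by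
    rw [he, hsup', hr x, hr y]
  have heinf : ∀ x y g, g ≤ e (inf x y) ↔ g ≤ e x ∧ g ≤ e y := fun x y g => by
    rw [he, hinf', hr x, hr y]
  let group : AddCommGroup (BLAlgebra.ChangGroup L) := e.addCommGroup
  let lattice : Lattice (BLAlgebra.ChangGroup L) :=
    { PartialOrder.lift e e.injective with
      sup := sup
      inf := inf
      le_sup_left := fun x y => ((hesup x y _).1 le_rfl).1
      le_sup_right := fun x y => ((hesup x y _).1 le_rfl).2
      sup_le := fun x y z h h' => (hesup x y _).2 ⟨h, h'⟩
      inf_le_left := fun x y => ((heinf x y _).1 le_rfl).1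
      inf_le_right := fun x y => ((heinf x y _).1 le_rfl).2
      le_inf := fun x y z h h' => (heinf y z _).2 ⟨h, h'⟩ }
  have hadd : ∀ x y : BLAlgebra.ChangGroup L, e (x + y) = e x + e y :=
    fun x y => e.apply_symm_apply _
  have hneg : ∀ x : BLAlgebra.ChangGroup L, e (-x) = -e x := fun x => e.apply_symm_apply _
  have hzero : e 0 = 0 := e.apply_symm_apply _
  have hele : ∀ x y : BLAlgebra.ChangGroup L, x ≤ y ↔ e x ≤ e y := fun _ _ => Iff.rfl
  refine ⟨heqv, fun a b => a.2.seqAdd b.2, fun a b => a.2.sup b.2, fun a b => a.2.inf b.2,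
    group, lattice, ?_, fun a b c d => ?_, fun a b => ?_, fun a b c d => ?_, fun x y z h => ?_,
    fun a b c d => ?_, fun a b c d => ?_⟩
  · exact e.injective (by rw [he, hzero, sub_self])
  · refine e.injective ?_
    rw [hadd, he, he]
    refine Eq.trans ?_ (he (a + c) (b + d)).symm
    rw [hψ, hψ, add_sub_add_comm]
  · exact e.injective (by rw [hneg, he, he, neg_sub])
  · rw [hele, he, he, sub_le_sub_iff, add_comm (ψ c), ← hψ, ← hψ, hle]
    rfl
  · rw [hele, hadd, hadd]
    exact add_le_add_left ((hele x y).1 h) _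
  -- The join of chosen representatives and the join of the given ones have the same upper bounds in
  -- `G`.
  · refine e.injective (eq_of_forall_ge_iff fun g => ?_)
    exact (hesup _ _ g).trans (hsup' a b c d g).symm
  · refine e.injective (eq_of_forall_le_iff fun g => ?_)
    exact (heinf _ _ g).trans (hinf' a b c d g).symm
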